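/- Let $R$ be a (unital) ring. A Sylvester module rank function on $R$ assigns to each finitely presented left $R$-module $M$ a real number $\dim M\ge 0$ such that $\dim 0=0$, $\dim R=1$, $\dim(M_1\oplus M_2)=\dim M_1+\dim M_2$, and $\dim M_1+\dim M_3\ge\dim M_2\ge\dim M_3$ whenever $M_1\to M_2\to M_3\to 0$ is exact. Let $\mathbb P(R)$ be the convex set of these functions. A Sylvester matrix rank function on a ring $U$ assigns to each matrix over $U$ a non-negative real number such that $\mathrm{rk}(0)=0$ for every zero matrix, $\mathrm{rk}(1)=1$, $\mathrm{rk}(AB)\le\min\{\mathrm{rk}(A),\mathrm{rk}(B)\}$, $\mathrm{rk}\begin{pmatrix}A&0\\0&B\end{pmatrix}=\mathrm{rk}(A)+\mathrm{rk}(B)$ and $\mathrm{rk}\begin{pmatrix}A&C\\0&B\end{pmatrix}\ge\mathrm{rk}(A)+\mathrm{rk}(B)$. The function $\dim\in\mathbb P(R)$ has the associated matrix rank function $A\mapsto m-\dim(R^m/R^nA)$ for $A\in\mathrm{Mat}_{n\times m}(R)$, and $\dim$ is called regular if this function is $A\mapsto \mathrm{rk}(\varphi(A))$ for some ring homomorphism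 $\varphi:R\to U$ to a von Neumann regular ring $U$ (for every $x\in U$ there is $y\in U$ with $xyx=x$) and some Sylvester matrix rank function $\mathrm{rk}$ on $U$. Let $\mathbb P_{\mathrm{reg}}(R)\subseteq\mathbb P(R)$ be the set of regular functions. **Theorem.** Let $\mathcal O$ be a Dedekind domain that is not a field, with field of fractions $Q$. Put $\dim_0(M)=\dim_Q(Q\otimes_{\mathcal O}M)$ and, for every maximal ideal $\mathfrak m$ and every integer $k\ge1$, let $$\dim_{\mathfrak m,k}(M)=\tfrac1k\,\mathrm{length}_{\mathcal O/\mathfrak m^k}\big(\mathcal O/\mathfrak m^k\otimes_{\mathcal O}M\big),$$ the pullback to $\mathcal O$ of the rank function $N\mapsto \frac1k\,\mathrm{length}(N)$ on $\mathcal O/\mathfrak m^k$. Then: 1. The extreme points of $\mathbb P(\mathcal O)$ are precisely $\dim_0$ and the functions $\dim_{\mathfrak m,k}$, for all maximal ideals $\mathfrak m$ and all $k\ge1$. 2. Every $\dim\in\mathbb P(\mathcal O)$ is a unique, possibly infinite, convex combination of these: there are unique real numbers $c_0,c_{\mathfrak m,k}\ge0$ with $c_0+\sum_{\mathfrak m,k}c_{\mathfrak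 m,k}=1$ and $$\dim(M)=c_0\dim_0(M)+\sum_{\mathfrak m}\sum_{k\ge1}c_{\mathfrak m,k}\dim_{\mathfrak m,k}(M)$$ for every finitely presented $\mathcal O$-module $M$ (in particular only countably many coefficients are non-zero). 3. If $\mathcal O$ contains a field, then $\mathbb P(\mathcal O)=\mathbb P_{\mathrm{reg}}(\mathcal O)$. -/

import Mathlib

open scoped TensorProduct

universe u

noncomputable section

namespace Sylvester

/-! Finitely presented modules and Sylvester module rank functions -/

/-- A finitely presented left module over the ring `R` (in the universe of `R`; every finitely
presented `R`-module is isomorphic to one of these). -/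
structure FPModule (R : Type u) [Ring R] : Type (u + 1) where
  carrier : Type u
  [addCommGroup : AddCommGroup carrier]
  [module : Module R carrier]
  [finitePresentation : Module.FinitePresentation R carrier]

attribute [instance] FPModule.addCommGroup FPModule.module FPModule.finitePresentation

/-- Bundle a finitely presented module. -/
abbrev FPModule.of (R : Type u) [Ring R] (M : Type u) [AddCommGroup M] [Module R M]
    [Module.FinitePresentation R M] : FPModule R where
  carrier := M

/-- `d` is a Sylvester module rank function on `R`. -/
structure IsModuleRank (R : Type u) [Ring R] (d : FPModule R → ℝ) : Prop where
  nonneg : ∀ M, 0 ≤ d M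
  zero : ∀ M : FPModule R, Subsingleton M.carrier → d M = 0
  one : d (.of R R) = 1
  prod : ∀ M N : FPModule R, d (.of R (M.carrier × N.carrier)) = d M + d N
  le_add_of_exact : ∀ (M₁ M₂ M₃ : FPModule R)
    (f : M₁.carrier →ₗ[R] M₂.carrier) (g : M₂.carrier →ₗ[R] M₃.carrier),
    Function.Exact f g → Function.Surjective g → d M₂ ≤ d M₁ + d M₃
  le_of_exact : ∀ (M₁ M₂ M₃ : FPModule R)
    (f : M₁.carrier →ₗ[R] M₂.carrier) (g : M₂.carrier →ₗ[R] M₃.carrier),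
    Function.Exact f g → Function.Surjective g → d M₃ ≤ d M₂

/-- The space `ℙ(R)` of Sylvester module rank functions on `R`, inside the real vector space of
all real-valued functions on finitely presented `R`-modules. -/
def rankSpace (R : Type u) [Ring R] : Set (FPModule R → ℝ) :=
  {d | IsModuleRank R d}

/-! Sylvester matrix rank functions and regularity -/

/-- The block matrix `(A C; 0 B)`. -/
def blockUpper {R : Type u} [Ring R] {n m k l : ℕ} (A : Matrix (Fin n) (Fin m) R)
    (C : Matrix (Fin n) (Fin l) R) (B : Matrix (Fin k) (Fin l) R) :
    Matrix (Fin (n + k)) (Fin (m + l)) R :=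
  Matrix.reindex finSumFinEquiv finSumFinEquiv (Matrix.fromBlocks A C 0 B)

/-- `rk` is a Sylvester matrix rank function on `R`. -/
structure IsMatrixRank (R : Type u) [Ring R]
    (rk : ∀ n m : ℕ, Matrix (Fin n) (Fin m) R → ℝ) : Prop where
  nonneg : ∀ n m (A : Matrix (Fin n) (Fin m) R), 0 ≤ rk n m A
  zero : ∀ n m, rk n m 0 = 0
  one : rk 1 1 1 = 1
  mul_le : ∀ n m l (A : Matrix (Fin n) (Fin m) R) (B : Matrix (Fin m) (Fin l) R),
    rk n l (A * B) ≤ min (rk n m A) (rk m l B)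
  diag : ∀ n m k l (A : Matrix (Fin n) (Fin m) R) (B : Matrix (Fin k) (Fin l) R),
    rk (n + k) (m + l) (blockUpper A 0 B) = rk n m A + rk k l B
  upper : ∀ n m k l (A : Matrix (Fin n) (Fin m) R) (C : Matrix (Fin n) (Fin l) R)
    (B : Matrix (Fin k) (Fin l) R),
    rk n m A + rk k l B ≤ rk (n + k) (m + l) (blockUpper A C B)

/-- The submodule `Rⁿ A` of `Rᵐ` for an `n × m` matrix `A`: the left span of its rows. -/
def rowSpan {R : Type u} [Ring R] {n m : ℕ} (A : Matrix (Fin n) (Fin m) R) :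
    Submodule R (Fin m → R) :=
  Submodule.span R (Set.range fun i => A i)

instance {R : Type u} [Ring R] {n m : ℕ} (A : Matrix (Fin n) (Fin m) R) :
    Module.FinitePresentation R ((Fin m → R) ⧸ rowSpan A) :=
  Module.finitePresentation_of_surjective (rowSpan A).mkQ (rowSpan A).mkQ_surjective (by
    rw [Submodule.ker_mkQ]
    exact Submodule.fg_span (Set.finite_range _))

/-- The matrix rank function associated to a module rank function `d`:
`rk(A) = m - d(Rᵐ / Rⁿ A)` for an `n × m` matrix `A`. -/
def matrixRankOf {R : Type u} [Ring R] (d : FPModule R → ℝ) (n m : ℕ)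
    (A : Matrix (Fin n) (Fin m) R) : ℝ :=
  (m : ℝ) - d (.of R ((Fin m → R) ⧸ rowSpan A))

/-- `U` is von Neumann regular. -/
def IsVonNeumannRegular (U : Type u) [Ring U] : Prop :=
  ∀ x : U, ∃ y : U, x * y * x = x

/-- The space of regular Sylvester rank functions on `R`: those whose associated matrix rank
function is of the form `A ↦ rk(φ(A))` for a ring homomorphism `φ` from `R` to a von Neumann
regular ring `U` and a Sylvester matrix rank function `rk` on `U`. -/
def regularRankSpace (R : Type u) [Ring R] : Set (FPModule R → ℝ) :=
  {d | d ∈ rankSpace R ∧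
    ∃ (U : Type u) (_ : Ring U) (φ : R →+* U)
      (rk : ∀ n m : ℕ, Matrix (Fin n) (Fin m) U → ℝ),
      IsVonNeumannRegular U ∧ IsMatrixRank U rk ∧
      ∀ n m (A : Matrix (Fin n) (Fin m) R), matrixRankOf d n m A = rk n m (A.map φ)}

/-! The rank functions `dim₀` and `dim_{𝔪,k}` -/

/-- The pullback along `R → S` of a module rank function on `S`. On associated matrix rank
functions it is `A ↦ rk(φ(A))`, because `S ⊗ (Rᵐ / Rⁿ A) ≅ Sᵐ / Sⁿ φ(A)`. -/
def pullback (R S : Type u) [CommRing R] [CommRing S] [Algebra R S] (d : FPModule S → ℝ) :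
    FPModule R → ℝ :=
  fun M => d (.of S (S ⊗[R] M.carrier))

/-- The dimension function of a field. -/
def fieldRank (K : Type u) [Field K] : FPModule K → ℝ :=
  fun V => (Module.finrank K V.carrier : ℝ)

/-- The function `N ↦ length(N) / k`. (On an artinian local ring `R` of length `k` with maximal
ideal `(c)` it takes the value `i / k` at `R / (c ^ i)` for `0 ≤ i ≤ k`.) -/
def lengthRank (R : Type u) [Ring R] (k : ℕ) : FPModule R → ℝ :=
  fun N => ((Module.length R N.carrier).toNat : ℝ) / k

/-- `dim₀`: induced by the dimension function of the field of fractions. -/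
def dimZero (O : Type u) [CommRing O] [IsDomain O] : FPModule O → ℝ :=
  pullback O (FractionRing O) (fieldRank (FractionRing O))

/-- `dim_{𝔪,k}`: pulled back from `O ⧸ 𝔪 ^ k`. -/
def dimPow {O : Type u} [CommRing O] (𝔪 : MaximalSpectrum O) (k : ℕ+) : FPModule O → ℝ :=
  pullback O (O ⧸ 𝔪.asIdeal ^ (k : ℕ)) (lengthRank (O ⧸ 𝔪.asIdeal ^ (k : ℕ)) k)

/-- The family consisting of `dim₀` (index `none`) and all the `dim_{𝔪,k}`. -/
def dimFamily (O : Type u) [CommRing O] [IsDomain O] :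
    Option (MaximalSpectrum O × ℕ+) → FPModule O → ℝ
  | none => dimZero O
  | some (𝔪, k) => dimPow 𝔪 k

end Sylvester

end

noncomputable section

namespace Sylvester

/-! Over a Dedekind domain a finitely generated module is its torsion submodule plus a projective
module, and a projective module splits successively into ideals. Every nonzero ideal has rank one
under any rank function (`ideal_eq_one`): an excess over one would give arbitrarily many pairwise
coprime `J` with `O ⧸ J` of rank at least that excess, while coprime quotients add up to one cyclic
module, of rank at most one. Hence a rank function is determined by the sequences `a k = d (O ⧸ m ^
k)` (`ext_of_quotient_pow`).

Each such sequence starts at 0, is monotone, bounded by 1 and concave (`quotient_pow_concave`),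
while `dim_{m,k}` gives the sequence `n ↦ min(n, k) / k`. A bounded monotone concave sequence is a
superposition of the functions `n ↦ min(n, k)`, weighted by its negated second differences, so the
coefficient of `dim_{m,k}` must be `k (2 a_k - a_{k-1} - a_{k+1})`. Coprimality of distinct primes
bounds the sum of all coefficients by 1; the leftover mass goes to `dim₀`, which vanishes on
torsion. Second differences read the coefficients off any expansion, which gives uniqueness, and the
extreme points follow formally.

If `O` contains a field, `K = O ⧸ m` is formally smooth over its prime field, so `O ⧸ m ^ k`
contains a copy of `K` and length over it is dimension over `K`. Then `O` acts through `End_K V` for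
`V = O ⧸ m ^ k`, a von Neumann regular ring with its normalized rank; `dim₀` is the case where `K =
V` is the field of fractions. The product of these rings carries the infinite convex combinations.
-/

instance (priority := low) finitePresentation_of_finite_of_isNoetherianRing (R : Type*) [Ring R]
    [IsNoetherianRing R] (M : Type*) [AddCommGroup M] [Module R M] [Module.Finite R M] :
    Module.FinitePresentation R M :=
  Module.finitePresentation_of_finite R M

/-! ### Formal properties of module rank functions -/

namespace IsModuleRank

section General

variable {R : Type u} [Ring R] {d : FPModule R → ℝ}
  {M N : Type u} [AddCommGroup M] [Module R M] [Module.FinitePresentation R M]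
  [AddCommGroup N] [Module R N] [Module.FinitePresentation R N]

theorem le_of_equiv (hd : IsModuleRank R d) (e : M ≃ₗ[R] N) : d (.of R M) ≤ d (.of R N) :=
  hd.le_of_exact (.of R PUnit) (.of R N) (.of R M) 0 (e.symm : N →ₗ[R] M)
    (by
      rw [LinearMap.exact_iff, LinearMap.range_zero]
      exact LinearEquiv.ker e.symm)
    e.symm.surjective

theorem congr (hd : IsModuleRank R d) (e : M ≃ₗ[R] N) : d (.of R M) = d (.of R N) :=
  le_antisymm (hd.le_of_equiv e) (hd.le_of_equiv e.symm)

theorem prod' (hd : IsModuleRank R d) : d (.of R (M × N)) = d (.of R M) + d (.of R N) :=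
  hd.prod (.of R M) (.of R N)

theorem of_subsingleton (hd : IsModuleRank R d) [Subsingleton M] : d (.of R M) = 0 :=
  hd.zero _ ‹_›

theorem pi_fin (hd : IsModuleRank R d) (n : ℕ) (X : Fin n → Type u) [∀ i, AddCommGroup (X i)]
    [∀ i, Module R (X i)] [∀ i, Module.FinitePresentation R (X i)]
    [Module.FinitePresentation R (∀ i, X i)] :
    d (.of R (∀ i, X i)) = ∑ i, d (.of R (X i)) := by
  -- Finite presentation of the product is proved in the same induction; by proof irrelevance the
  -- formula then holds for the given instance.
  have key : ∀ (n : ℕ) (X : Fin n → Type u) [∀ i, AddCommGroup (X i)]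
      [∀ i, Module R (X i)] [∀ i, Module.FinitePresentation R (X i)],
      ∃ h : Module.FinitePresentation R (∀ i, X i),
        d (.of R (∀ i, X i)) = ∑ i, d (.of R (X i)) := by
    intro n
    induction n with
    | zero =>
      intro X _ _ _
      have e : PUnit.{u + 1} ≃ₗ[R] (∀ i, X i) := 0
      have h := Module.FinitePresentation.of_equiv e
      exact ⟨h, by rw [hd.of_subsingleton]; simp⟩
    | succ n ih =>
      intro X _ _ _
      obtain ⟨h, hs⟩ := ih (fun i => X i.succ)
      let e : (X 0 × ∀ i : Fin n, X i.succ) ≃ₗ[R] (∀ i, X i) := Fin.consLinearEquiv R X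
      have h' := Module.FinitePresentation.of_equiv e
      exact ⟨h', by rw [← hd.congr e, hd.prod', hs, Fin.sum_univ_succ]⟩
  exact (key n X).2

theorem pi (hd : IsModuleRank R d) {ι : Type*} [Fintype ι] (X : ι → Type u)
    [∀ i, AddCommGroup (X i)]
    [∀ i, Module R (X i)] [∀ i, Module.FinitePresentation R (X i)]
    (N : Type u) [AddCommGroup N] [Module R N] [Module.FinitePresentation R N]
    (e : N ≃ₗ[R] ∀ i, X i) :
    d (.of R N) = ∑ i, d (.of R (X i)) := by
  let σ := (Fintype.equivFin ι).symm
  let e' : N ≃ₗ[R] (∀ j, X (σ j)) := e.trans (LinearEquiv.piCongrLeft R X σ).symm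
  have := Module.FinitePresentation.of_equiv e'
  rw [hd.congr e', hd.pi_fin, ← σ.sum_comp]

theorem free (hd : IsModuleRank R d) (n : ℕ) : d (.of R (Fin n → R)) = n := by
  rw [hd.pi (fun _ : Fin n => R) _ (LinearEquiv.refl _ _), hd.one]
  simp

end General

section Noetherian

variable {R : Type u} [CommRing R] [IsNoetherianRing R] {d : FPModule R → ℝ}
  {M N P : Type u} [AddCommGroup M] [Module R M] [Module.Finite R M]
  [AddCommGroup N] [Module R N] [Module.Finite R N]
  [AddCommGroup P] [Module R P] [Module.Finite R P]

theorem le_add (hd : IsModuleRank R d) (f : M →ₗ[R] N) (g : N →ₗ[R] P)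
    (h : Function.Exact f g) (hg : Function.Surjective g) :
    d (.of R N) ≤ d (.of R M) + d (.of R P) :=
  hd.le_add_of_exact (.of R M) (.of R N) (.of R P) f g h hg

theorem le_of_surjective (hd : IsModuleRank R d) (f : M →ₗ[R] N) (hf : Function.Surjective f) :
    d (.of R N) ≤ d (.of R M) :=
  hd.le_of_exact (.of R (LinearMap.ker f)) (.of R M) (.of R N) (LinearMap.ker f).subtype f
    (LinearMap.exact_subtype_ker_map f) hf

/-- A surjection onto a projective module splits. -/
theorem eq_ker_add_of_projective (hd : IsModuleRank R d) [Module.Projective R P] (g : N →ₗ[R] P)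
    (hg : Function.Surjective g) :
    d (.of R N) = d (.of R (LinearMap.ker g)) + d (.of R P) := by
  obtain ⟨s, hs⟩ := Module.projective_lifting_property g LinearMap.id hg
  rw [← hd.prod']
  exact hd.congr (lequivProdOfRightSplitExact (LinearMap.ker g).injective_subtype
    (Submodule.range_subtype _) hs).symm

/-- The bound is uniform in `d`; this makes infinite convex combinations of rank functions converge
at each module. -/
theorem exists_forall_le (M : FPModule R) :
    ∃ n : ℕ, ∀ d : FPModule R → ℝ, IsModuleRank R d → d M ≤ n := by
  obtain ⟨n, f, hf⟩ := Module.Finite.exists_fin' R M.carrier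
  refine ⟨n, fun d hd => ?_⟩
  rw [← hd.free n]
  exact hd.le_of_surjective f hf

end Noetherian

end IsModuleRank

/-! ### Nonzero ideals have rank one -/

section Ideals

variable {O : Type u} [CommRing O] [IsDedekindDomain O]

/-- An ideal modulo a nonzero subideal is cyclic. If `J' ≠ ⊤`, the generator `x` of `I` modulo `I *
J'` is nonzero, since otherwise `I * J' = I` and cancelling `I` gives `J' = ⊤`. -/
theorem exists_ne_zero_mul_sup_span_eq {I J' : Ideal O} (hI : I ≠ ⊥) (hJ' : J' ≠ ⊥) :
    ∃ x ∈ I, x ≠ 0 ∧ I * J' ⊔ Ideal.span {x} = I := by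
  by_cases h : J' = ⊤
  · obtain ⟨x, hx, hx0⟩ := Submodule.exists_mem_ne_zero_of_ne_bot hI
    refine ⟨x, hx, hx0, ?_⟩
    rw [h, Ideal.mul_top, sup_eq_left]
    exact (Ideal.span_singleton_le_iff_mem I).mpr hx
  · obtain ⟨x, hx⟩ := IsDedekindDomain.exists_sup_span_eq (I := I * J') (J := I)
      Ideal.mul_le_left (mul_ne_zero hI hJ')
    refine ⟨x, ?_, ?_, hx⟩
    · rw [← hx]
      exact Ideal.mem_sup_right (Ideal.mem_span_singleton_self x)
    · rintro rfl
      rw [Ideal.span_singleton_eq_bot.mpr rfl, sup_bot_eq] at hx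
      exact h ((mul_left_cancel₀ (b := J') (c := 1) hI (by rw [hx, mul_one])).trans Ideal.one_eq_top)

/-- The rank of a nonzero ideal exceeds one by at most the rank of a cyclic torsion module whose
support avoids any given finite set of primes. -/
theorem exists_isCoprime_le_one_add {I J' : Ideal O} (hI : I ≠ ⊥) (hJ' : J' ≠ ⊥) :
    ∃ J : Ideal O, J ≠ ⊥ ∧ IsCoprime J J' ∧
      ∀ d : FPModule O → ℝ, IsModuleRank O d → d (.of O I) ≤ 1 + d (.of O (O ⧸ J)) := by
  obtain ⟨x, hxI, hx0, hx⟩ := exists_ne_zero_mul_sup_span_eq hI hJ'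
  obtain ⟨y, hy⟩ := IsDedekindDomain.exists_sup_span_eq
    ((Ideal.span_singleton_le_iff_mem I).mpr hxI) (by simpa using hx0)
  have hyI : y ∈ I := by
    rw [← hy]
    exact Ideal.mem_sup_right (Ideal.mem_span_singleton_self y)
  -- With `I = (x) + (y)`, this is the annihilator of the class of `y` in `I / (x)`, so `O ⧸ J` maps
  -- onto `I / (x)`.
  let J : Ideal O := Submodule.comap (LinearMap.toSpanSingleton O O y) (Ideal.span {x})
  have memJ : ∀ r, r ∈ J ↔ r * y ∈ Ideal.span {x} := fun r => Iff.rfl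
  refine ⟨J, ?_, ?_, fun d hd => ?_⟩
  · rw [Submodule.ne_bot_iff]
    exact ⟨x, (memJ x).mpr (Ideal.mul_mem_right _ _ (Ideal.mem_span_singleton_self x)), hx0⟩
  -- Here `y` lies in `(x) J' + (y) J' + (x)`, so `(1 - j₂) y ∈ (x)` for some `j₂ ∈ J'`, which puts
  -- `1 - j₂` in `J`.
  · have hy' : y ∈ I * J' ⊔ Ideal.span {x} := hx.symm.le hyI
    have hI' : I * J' = Ideal.span {x} * J' ⊔ Ideal.span {y} * J' := by
      rw [← Ideal.sup_mul, hy]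
    rw [hI'] at hy'
    obtain ⟨i, hi, w, hw, rfl⟩ := Submodule.mem_sup.mp hy'
    obtain ⟨i₁, hi₁, i₂, hi₂, rfl⟩ := Submodule.mem_sup.mp hi
    obtain ⟨j₂, hj₂, h₂⟩ := Ideal.mem_span_singleton_mul.mp hi₂
    rw [Ideal.isCoprime_iff_exists]
    refine ⟨1 - j₂, (memJ _).mpr ?_, j₂, hj₂, by ring⟩
    have : (1 - j₂) * (i₁ + i₂ + w) = i₁ + w := by
      rw [sub_mul, mul_comm j₂, h₂]
      ring
    rw [this]
    exact add_mem (Ideal.mul_le_left hi₁) hw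
  · let x' : I := ⟨x, hxI⟩
    let y' : I := ⟨y, hyI⟩
    let q : Submodule O I := Submodule.span O {x'}
    have h₁ : d (.of O I) ≤ d (.of O O) + d (.of O (I ⧸ q)) :=
      hd.le_add (LinearMap.toSpanSingleton O I x') q.mkQ
        (by rw [LinearMap.exact_iff, Submodule.ker_mkQ, LinearMap.range_toSpanSingleton])
        q.mkQ_surjective
    let f : (O ⧸ J) →ₗ[O] (I ⧸ q) :=
      J.liftQ (q.mkQ ∘ₗ LinearMap.toSpanSingleton O I y') (by
        intro r hr
        obtain ⟨c, hc⟩ := Ideal.mem_span_singleton'.mp ((memJ r).mp hr)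
        rw [LinearMap.mem_ker, LinearMap.comp_apply, Submodule.mkQ_apply,
          Submodule.Quotient.mk_eq_zero]
        exact Submodule.mem_span_singleton.mpr ⟨c, Subtype.ext hc⟩)
    have hf : Function.Surjective f := by
      intro z
      obtain ⟨⟨z, hz⟩, rfl⟩ := q.mkQ_surjective z
      have hz' := hz
      rw [← hy] at hz'
      obtain ⟨a, ha, b, hb, rfl⟩ := Submodule.mem_sup.mp hz'
      obtain ⟨a, rfl⟩ := Ideal.mem_span_singleton'.mp ha
      obtain ⟨b, rfl⟩ := Ideal.mem_span_singleton'.mp hb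
      refine ⟨Submodule.Quotient.mk b, ?_⟩
      change q.mkQ (b • y') = _
      rw [Submodule.mkQ_apply, Submodule.mkQ_apply, eq_comm, Submodule.Quotient.eq]
      refine Submodule.mem_span_singleton.mpr ⟨a, Subtype.ext ?_⟩
      simp [x', y']
    have h₂ := hd.le_of_surjective f hf
    rw [hd.one] at h₁
    linarith

theorem IsModuleRank.quotient_le_one {d : FPModule O → ℝ} (hd : IsModuleRank O d) (J : Ideal O) :
    d (.of O (O ⧸ J)) ≤ 1 := by
  rw [← hd.one]
  exact hd.le_of_surjective J.mkQ J.mkQ_surjective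

theorem IsModuleRank.quotient_mul {d : FPModule O → ℝ} (hd : IsModuleRank O d) {J J' : Ideal O}
    (h : IsCoprime J J') :
    d (.of O (O ⧸ J * J')) = d (.of O (O ⧸ J)) + d (.of O (O ⧸ J')) := by
  rw [← hd.prod']
  refine hd.congr (LinearEquiv.ofBijective
    ((Submodule.factor Ideal.mul_le_left).prod (Submodule.factor Ideal.mul_le_right)) ?_)
  convert (Ideal.quotientMulEquivQuotientProd J J' h).bijective using 1
  funext x
  obtain ⟨x, rfl⟩ := Ideal.Quotient.mk_surjective x
  rfl

/-- If the rank were `1 + ε`, multiplying `n` successively coprime ideals would give a cyclic module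
of rank at least `n ε`, contradicting the bound 1 for large `n`. -/
theorem IsModuleRank.ideal_le_one {d : FPModule O → ℝ} (hd : IsModuleRank O d) (I : Ideal O) :
    d (.of O I) ≤ 1 := by
  rcases eq_or_ne I ⊥ with rfl | hI
  · rw [hd.of_subsingleton]
    exact zero_le_one
  · have key : ∀ n : ℕ, ∃ J : Ideal O, J ≠ ⊥ ∧ n * (d (.of O I) - 1) ≤ d (.of O (O ⧸ J)) := by
      intro n
      induction n with
      | zero => exact ⟨⊤, top_ne_bot, by simpa using hd.nonneg _⟩
      | succ n ih =>
        obtain ⟨J', hJ', h'⟩ := ih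
        obtain ⟨J, hJ, hJJ', h⟩ := exists_isCoprime_le_one_add hI hJ'
        refine ⟨J * J', mul_ne_zero hJ hJ', ?_⟩
        rw [hd.quotient_mul hJJ']
        have := h d hd
        push_cast
        linarith
    by_contra! hlt
    obtain ⟨n, hn⟩ := Archimedean.arch 2 (sub_pos.mpr hlt)
    obtain ⟨J, -, hJ⟩ := key n
    have := hd.quotient_le_one J
    rw [nsmul_eq_mul] at hn
    linarith

/-- A nonzero ideal of a Dedekind domain has rank one. -/
theorem IsModuleRank.ideal_eq_one {d : FPModule O → ℝ} (hd : IsModuleRank O d) {I : Ideal O}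
    (hI : I ≠ ⊥) : d (.of O I) = 1 := by
  refine le_antisymm (hd.ideal_le_one I) ?_
  obtain ⟨x, hxI, hx0⟩ := Submodule.exists_mem_ne_zero_of_ne_bot hI
  obtain ⟨y, hy⟩ := IsDedekindDomain.exists_sup_span_eq
    ((Ideal.span_singleton_le_iff_mem I).mpr hxI) (by simpa using hx0)
  have hyI : y ∈ I := by
    rw [← hy]
    exact Ideal.mem_sup_right (Ideal.mem_span_singleton_self y)
  -- Two generators map `O²` onto `I`. As `x ≠ 0`, the second coordinate embeds the kernel in `O`,
  -- so the kernel has rank at most one and `2 ≤ 1 + d(I)`.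
  let g : (O × O) →ₗ[O] I := (LinearMap.toSpanSingleton O I ⟨x, hxI⟩).coprod
    (LinearMap.toSpanSingleton O I ⟨y, hyI⟩)
  have hg : ∀ a b, (g (a, b) : O) = a * x + b * y := fun a b => by simp [g]
  have hgs : Function.Surjective g := by
    rintro ⟨z, hz⟩
    have hz' := hz
    rw [← hy] at hz'
    obtain ⟨a, ha, b, hb, rfl⟩ := Submodule.mem_sup.mp hz'
    obtain ⟨a, rfl⟩ := Ideal.mem_span_singleton'.mp ha
    obtain ⟨b, rfl⟩ := Ideal.mem_span_singleton'.mp hb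
    exact ⟨(a, b), Subtype.ext (hg a b)⟩
  let p : LinearMap.ker g →ₗ[O] O := LinearMap.snd O O O ∘ₗ (LinearMap.ker g).subtype
  have hp : Function.Injective p := by
    rw [injective_iff_map_eq_zero]
    rintro ⟨⟨a, b⟩, hab⟩ h
    have hb : b = 0 := h
    have h0 := hg a b
    rw [LinearMap.mem_ker.mp hab, hb] at h0
    have : a = 0 := by simpa [hx0] using h0.symm
    simp [this, hb]
  have h₁ := hd.le_add (LinearMap.ker g).subtype g (LinearMap.exact_subtype_ker_map g) hgs
  have h₂ : d (.of O (LinearMap.ker g)) ≤ 1 := by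
    rw [hd.congr (LinearEquiv.ofInjective p hp)]
    exact hd.ideal_le_one _
  rw [hd.prod', hd.one] at h₁
  linarith

end Ideals

/-! ### Rank functions are determined by the modules `O ⧸ m ^ k` -/

section Determination

variable {O : Type u} [CommRing O] [IsDedekindDomain O] {d d' : FPModule O → ℝ}

theorem IsModuleRank.eq_ker_add_range (hd : IsModuleRank O d) {N P : Type u} [AddCommGroup N]
    [Module O N] [Module.Finite O N] [AddCommGroup P] [Module O P] [Module.Finite O P]
    (g : N →ₗ[O] P) [Module.Projective O (LinearMap.range g)] :
    d (.of O N) = d (.of O (LinearMap.ker g)) + d (.of O (LinearMap.range g)) := by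
  have h := hd.eq_ker_add_of_projective g.rangeRestrict g.surjective_rangeRestrict
  rwa [← hd.congr (LinearEquiv.ofEq _ _ g.ker_rangeRestrict)]

/-- The first coordinate maps `N` onto an ideal, which is projective and splits off; its rank is 0
or 1 for every rank function. The kernel embeds in one coordinate fewer. -/
theorem IsModuleRank.eq_of_injective_pi (hd : IsModuleRank O d) (hd' : IsModuleRank O d') (n : ℕ)
    (N : Type u) [AddCommGroup N] [Module O N] [Module.Finite O N] (f : N →ₗ[O] (Fin n → O))
    (hf : Function.Injective f) : d (.of O N) = d' (.of O N) := by
  induction n generalizing N with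
  | zero =>
    have := hf.subsingleton
    rw [hd.of_subsingleton, hd'.of_subsingleton]
  | succ n ih =>
    let g : N →ₗ[O] O := LinearMap.proj 0 ∘ₗ f
    have : Module.Projective O (LinearMap.range g) := Module.Flat.projective_of_finitePresentation
    let t : LinearMap.ker g →ₗ[O] (Fin n → O) :=
      LinearMap.funLeft O O Fin.succ ∘ₗ f ∘ₗ (LinearMap.ker g).subtype
    have ht : Function.Injective t := by
      rw [injective_iff_map_eq_zero]
      rintro ⟨v, hv⟩ h
      refine Subtype.ext (hf ?_)
      rw [ZeroMemClass.coe_zero, map_zero]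
      funext i
      refine Fin.cases ?_ (fun j => ?_) i
      · exact hv
      · exact congrFun h j
    have hr : d (.of O (LinearMap.range g)) = d' (.of O (LinearMap.range g)) := by
      by_cases h : LinearMap.range g = ⊥
      · have : Subsingleton (LinearMap.range g) := by rw [h]; infer_instance
        rw [hd.of_subsingleton, hd'.of_subsingleton]
      · rw [hd.ideal_eq_one h, hd'.ideal_eq_one h]
    rw [hd.eq_ker_add_range g, hd'.eq_ker_add_range g, hr, ih _ t ht]

theorem IsModuleRank.eq_of_isTorsionFree (hd : IsModuleRank O d) (hd' : IsModuleRank O d')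
    (M : Type u) [AddCommGroup M] [Module O M] [Module.Finite O M] [Module.IsTorsionFree O M] :
    d (.of O M) = d' (.of O M) := by
  have : Module.Projective O M := Module.Flat.projective_of_finitePresentation
  obtain ⟨n, f, hf⟩ := Module.Finite.exists_fin' O M
  obtain ⟨s, hs⟩ := Module.projective_lifting_property f LinearMap.id hf
  exact hd.eq_of_injective_pi hd' n M s
    (Function.LeftInverse.injective (g := f) fun x => LinearMap.congr_fun hs x)

open IsLocalization.AtPrime in
/-- A finitely generated module killed by a power of a maximal ideal `m` is a finite direct sum of
modules `O ⧸ m ^ k`. -/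
theorem exists_equiv_pi_quotient_pow {m : Ideal O} [m.IsMaximal] (hm : m ≠ ⊥) (e : ℕ)
    (M : Type u) [AddCommGroup M] [Module O M] [Module.Finite O M]
    (hM : ∀ r ∈ m ^ e, ∀ x : M, r • x = 0) :
    ∃ (n : ℕ) (k : Fin n → ℕ), Nonempty (M ≃ₗ[O] ∀ i, O ⧸ m ^ k i) := by
  let S := m.primeCompl
  let L := Localization.AtPrime m
  -- Elements outside `m` are invertible modulo `m ^ e`, so they act bijectively and `M` is its own
  -- localization at `m`. The structure theorem over the discrete valuation ring `L` then applies.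
  have hloc : IsLocalizedModule S (LinearMap.id : M →ₗ[O] M) := by
    constructor
    · rintro ⟨s, hs⟩
      have hc : IsCoprime (Ideal.span {s}) (m ^ e) := by
        obtain ⟨y, i, hi, h⟩ := Ideal.IsMaximal.exists_inv ‹_› hs
        exact IsCoprime.pow_right (Ideal.isCoprime_iff_exists.mpr
          ⟨_, Ideal.mem_span_singleton'.mpr ⟨y, rfl⟩, i, hi, h⟩)
      obtain ⟨a, ha, b, hb, hab⟩ := Ideal.isCoprime_iff_exists.mp hc
      obtain ⟨c, rfl⟩ := Ideal.mem_span_singleton'.mp ha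
      have h1 : ∀ x : M, (c * s) • x = x := fun x => by
        conv_rhs => rw [← one_smul O x, ← hab, add_smul, hM b hb, add_zero]
      refine (Module.End.isUnit_iff _).mpr ⟨?_, ?_⟩
      · intro x y hxy
        have hxy : s • x = s • y := hxy
        rw [← h1 x, ← h1 y, mul_smul, mul_smul, hxy]
      · intro x
        exact ⟨c • x, by
          change s • c • x = x
          rw [smul_smul, mul_comm, h1]⟩
    · exact fun y => ⟨(y, 1), by simp⟩
    · exact fun h => ⟨1, by simpa using h⟩
  let X := LocalizedModule S M
  let ε : X ≃ₗ[O] M := IsLocalizedModule.iso S LinearMap.id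
  have hfin : Module.Finite L X := Module.Finite.of_isLocalizedModule S (LocalizedModule.mkLinearMap S M)
  have : IsDiscreteValuationRing L := isDiscreteValuationRing_of_dedekind_domain O hm L
  obtain ⟨p, hp⟩ := IsDiscreteValuationRing.exists_irreducible L
  have hX : ∀ r ∈ IsLocalRing.maximalIdeal L ^ e, ∀ x : X, r • x = 0 := by
    intro r hr x
    rw [← Localization.AtPrime.map_eq_maximalIdeal, ← Ideal.map_pow] at hr
    suffices Ideal.map (algebraMap O L) (m ^ e) ≤ Module.annihilator L X from
      Module.mem_annihilator.mp (this hr) x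
    rw [Ideal.map_le_iff_le_comap]
    intro r hr
    rw [Ideal.mem_comap, Module.mem_annihilator]
    intro x
    rw [algebraMap_smul]
    apply ε.injective
    rw [map_smul, hM r hr, map_zero]
  obtain ⟨n, k, ⟨f⟩⟩ := Module.torsion_by_prime_power_decomposition (M := X) hp (fun x =>
    ⟨⟨p ^ e, e, rfl⟩, hX _ (Ideal.pow_mem_pow (hp.maximalIdeal_eq ▸
      Ideal.mem_span_singleton_self p) e) x⟩)
  have h : ∀ i, Submodule.span L {p ^ k i} = IsLocalRing.maximalIdeal L ^ k i := fun i => by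
    rw [hp.maximalIdeal_eq, Ideal.span_singleton_pow]
  let ε' : ∀ i, (L ⧸ Submodule.span L {p ^ k i}) ≃ₗ[O] (O ⧸ m ^ k i) := fun i =>
    ((Submodule.quotEquivOfEq _ _ (h i)).restrictScalars O).trans
      (equivQuotMaximalIdealPow m L (k i)).toLinearEquiv.symm
  refine ⟨n, k, ⟨ε.symm.trans ((f.restrictScalars O).trans
    (((DirectSum.linearEquivFunOnFintype L (Fin n) _).restrictScalars O).trans
      (LinearEquiv.piCongrRight fun i => ε' i)))⟩⟩

/-- A rank function on a Dedekind domain is determined by its values at the modules `O ⧸ m ^ k`. -/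
theorem IsModuleRank.ext_of_quotient_pow (hd : IsModuleRank O d) (hd' : IsModuleRank O d')
    (h : ∀ (m : Ideal O) (k : ℕ), m.IsMaximal → m ≠ ⊥ →
      d (.of O (O ⧸ m ^ k)) = d' (.of O (O ⧸ m ^ k))) : d = d' := by
  have htor : ∀ (M : Type u) [AddCommGroup M] [Module O M] [Module.Finite O M],
      Module.IsTorsion O M → d (.of O M) = d' (.of O M) := by
    intro M _ _ _ hM
    obtain ⟨P, _, hP, e, hint⟩ := Submodule.exists_isInternal_prime_power_torsion hM
    let ε := ((LinearEquiv.ofBijective (DirectSum.coeLinearMap _) hint).symm.trans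
      (DirectSum.linearEquivFunOnFintype O P _))
    rw [hd.pi _ _ ε, hd'.pi _ _ ε]
    refine Finset.sum_congr rfl fun p _ => ?_
    have hp0 : (p : Ideal O) ≠ ⊥ := (hP p p.2).ne_zero
    have hpm : (p : Ideal O).IsMaximal := (Ideal.isPrime_of_prime (hP p p.2)).isMaximal hp0
    obtain ⟨n, k, ⟨f⟩⟩ := exists_equiv_pi_quotient_pow hp0 (e p)
      (Submodule.torsionBySet O M ((p : Ideal O) ^ e p : Ideal O)) (fun r hr x =>
        Subtype.ext ((Submodule.mem_torsionBySet_iff _ _).mp x.2 ⟨r, hr⟩))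
    rw [hd.pi _ _ f, hd'.pi _ _ f]
    exact Finset.sum_congr rfl fun i _ => h _ _ hpm hp0
  funext M
  change d (.of O M.carrier) = d' (.of O M.carrier)
  -- The torsion-free quotient is projective, so the torsion submodule splits off and the two parts
  -- are compared separately.
  have : Module.Projective O (M.carrier ⧸ Submodule.torsion O M.carrier) :=
    Module.Flat.projective_of_finitePresentation
  let q := (Submodule.torsion O M.carrier).mkQ
  have hq := (Submodule.torsion O M.carrier).mkQ_surjective
  rw [hd.eq_ker_add_of_projective q hq, hd'.eq_ker_add_of_projective q hq,
    hd.eq_of_isTorsionFree hd' (M.carrier ⧸ Submodule.torsion O M.carrier), htor]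
  rw [Submodule.ker_mkQ]
  exact Submodule.torsion_isTorsion

end Determination

/-! ### The functions `dim₀` and `dim_{𝔪,k}` and their values -/

theorem IsModuleRank.pullback {R S : Type u} [CommRing R] [CommRing S] [Algebra R S]
    {d : FPModule S → ℝ} (hd : IsModuleRank S d) : IsModuleRank R (pullback R S d) where
  nonneg M := hd.nonneg _
  zero M hM := hd.zero _ (inferInstanceAs (Subsingleton (S ⊗[R] M.carrier)))
  one := by
    rw [← hd.one]
    exact hd.congr (TensorProduct.AlgebraTensorModule.rid R S S)
  prod M N := by
    refine (hd.congr (TensorProduct.prodRight R S S M.carrier N.carrier)).trans ?_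
    exact hd.prod' (M := S ⊗[R] M.carrier) (N := S ⊗[R] N.carrier)
  le_add_of_exact M₁ M₂ M₃ f g h hg :=
    hd.le_add_of_exact (.of S (S ⊗[R] M₁.carrier)) (.of S (S ⊗[R] M₂.carrier))
      (.of S (S ⊗[R] M₃.carrier)) (f.baseChange S) (g.baseChange S)
      (lTensor_exact S h hg) (LinearMap.lTensor_surjective S hg)
  le_of_exact M₁ M₂ M₃ f g h hg :=
    hd.le_of_exact (.of S (S ⊗[R] M₁.carrier)) (.of S (S ⊗[R] M₂.carrier))
      (.of S (S ⊗[R] M₃.carrier)) (f.baseChange S) (g.baseChange S)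
      (lTensor_exact S h hg) (LinearMap.lTensor_surjective S hg)

/-- Over an artinian ring all these lengths are finite, so `toNat` loses nothing, and the
inequalities come from additivity of length. -/
theorem isModuleRank_lengthRank {R : Type u} [CommRing R] [IsArtinianRing R] {k : ℕ} (hk : 0 < k)
    (h : Module.length R R = k) : IsModuleRank R (lengthRank R k) := by
  have hfin : ∀ M : FPModule R, Module.length R M.carrier ≠ ⊤ := fun M => Module.length_ne_top
  have hk' : (0 : ℝ) < k := by exact_mod_cast hk
  constructor
  · intro M
    unfold lengthRank
    positivity
  · intro M hM
    simp [lengthRank]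
  · change ((Module.length R R).toNat : ℝ) / k = 1
    rw [h, ENat.toNat_natCast, div_self hk'.ne']
  · intro M N
    change ((Module.length R (M.carrier × N.carrier)).toNat : ℝ) / k = _
    rw [Module.length_prod, ENat.toNat_add (hfin M) (hfin N)]
    push_cast
    rw [add_div]
    rfl
  · intro M₁ M₂ M₃ f g hfg hg
    unfold lengthRank
    rw [← add_div]
    refine div_le_div_of_nonneg_right ?_ hk'.le
    rw [← Nat.cast_add, Nat.cast_le, ← ENat.toNat_add (hfin _) (hfin _)]
    refine ENat.toNat_le_toNat ?_ (WithTop.add_ne_top.mpr ⟨hfin _, hfin _⟩)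
    rw [Module.length_eq_add_of_exact (LinearMap.range f).subtype g
      (Submodule.subtype_injective _) hg (by
        rw [LinearMap.exact_iff, Submodule.range_subtype]; exact LinearMap.exact_iff.mp hfg)]
    gcongr
    exact Module.length_le_of_surjective f.rangeRestrict f.surjective_rangeRestrict
  · intro M₁ M₂ M₃ f g hfg hg
    unfold lengthRank
    refine div_le_div_of_nonneg_right ?_ hk'.le
    rw [Nat.cast_le]
    exact ENat.toNat_le_toNat (Module.length_le_of_surjective g hg) (hfin _)

theorem isModuleRank_fieldRank (K : Type u) [Field K] : IsModuleRank K (fieldRank K) := by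
  have h : fieldRank K = lengthRank K 1 := by
    funext V
    simp [fieldRank, lengthRank, Module.length_eq_finrank]
  rw [h]
  exact isModuleRank_lengthRank one_pos (by simp)

theorem length_tensor_quotient {R : Type u} [CommRing R] (I J : Ideal R) :
    Module.length (R ⧸ I) ((R ⧸ I) ⊗[R] (R ⧸ J)) = Module.length R (R ⧸ (I ⊔ J)) := by
  rw [← Module.length_eq_of_surjective (S := R) Ideal.Quotient.mk_surjective]
  refine LinearEquiv.length_eq ((TensorProduct.quotientTensorQuotientEquiv I J).trans
    (Submodule.Quotient.equiv _ _ (TensorProduct.lid R R) ?_))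
  rw [Submodule.map_sup, ← LinearMap.range_comp, ← LinearMap.range_comp]
  congr 1
  · ext x
    constructor
    · rintro ⟨y, rfl⟩
      induction y with
      | zero => simp
      | tmul a b => exact I.mul_mem_right _ a.2
      | add a b ha hb => rw [map_add]; exact add_mem ha hb
    · intro hx
      exact ⟨⟨x, hx⟩ ⊗ₜ 1, by simp⟩
  · ext x
    constructor
    · rintro ⟨y, rfl⟩
      induction y with
      | zero => simp
      | tmul a b => exact J.mul_mem_left _ b.2
      | add a b ha hb => rw [map_add]; exact add_mem ha hb
    · intro hx
      exact ⟨1 ⊗ₜ ⟨x, hx⟩, by simp⟩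

section Dedekind

variable {O : Type u} [CommRing O] [IsDedekindDomain O]

/-- Localizing at `m` does not change `O ⧸ m ^ k`, and length is insensitive to the base ring along
surjections, so the count is that of a discrete valuation ring. -/
theorem length_quotient_pow {m : Ideal O} [m.IsMaximal] (hm : m ≠ ⊥) (k : ℕ) :
    Module.length O (O ⧸ m ^ k) = k := by
  let L := Localization.AtPrime m
  have : IsDiscreteValuationRing L :=
    IsLocalization.AtPrime.isDiscreteValuationRing_of_dedekind_domain O hm L
  let e := IsLocalization.AtPrime.equivQuotMaximalIdealPow m L k
  have hs : Function.Surjective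
      (algebraMap O (L ⧸ IsLocalRing.maximalIdeal L ^ k)) := by
    intro x
    obtain ⟨y, rfl⟩ := e.surjective x
    obtain ⟨y, rfl⟩ := Ideal.Quotient.mk_surjective y
    exact ⟨y, (e.commutes y).symm⟩
  rw [← IsDiscreteValuationRing.length_quotient_pow_maximalIdeal (R := L) k,
    e.toLinearEquiv.length_eq, Module.length_eq_of_surjective hs,
    ← Module.length_eq_of_surjective (S := L) (R := L ⧸ IsLocalRing.maximalIdeal L ^ k)
      Ideal.Quotient.mk_surjective]

theorem length_quotient_pow_self {m : Ideal O} [m.IsMaximal] (hm : m ≠ ⊥) (k : ℕ) :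
    Module.length (O ⧸ m ^ k) (O ⧸ m ^ k) = k := by
  rw [← length_quotient_pow hm k,
    ← Module.length_eq_of_surjective (S := O) Ideal.Quotient.mk_surjective]

theorem isArtinianRing_quotient_pow {m : Ideal O} [m.IsMaximal] (hm : m ≠ ⊥) (k : ℕ) :
    IsArtinianRing (O ⧸ m ^ k) := by
  rw [isArtinianRing_iff_isFiniteLength, ← Module.length_ne_top_iff, length_quotient_pow_self hm]
  exact ENat.natCast_ne_top k

theorem MaximalSpectrum.asIdeal_ne_bot (hO : ¬ IsField O) (m : MaximalSpectrum O) :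
    m.asIdeal ≠ ⊥ :=
  Ring.ne_bot_of_isMaximal_of_not_isField m.isMaximal hO

theorem isModuleRank_dimZero : IsModuleRank O (dimZero O) :=
  (isModuleRank_fieldRank _).pullback

theorem isModuleRank_dimPow (hO : ¬ IsField O) (m : MaximalSpectrum O) (k : ℕ+) :
    IsModuleRank O (dimPow m k) := by
  have := isArtinianRing_quotient_pow (MaximalSpectrum.asIdeal_ne_bot hO m) k
  exact (isModuleRank_lengthRank k.pos
    (length_quotient_pow_self (MaximalSpectrum.asIdeal_ne_bot hO m) k)).pullback

theorem isModuleRank_dimFamily (hO : ¬ IsField O) (i : Option (MaximalSpectrum O × ℕ+)) :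
    IsModuleRank O (dimFamily O i) := by
  rcases i with _ | ⟨m, k⟩
  · exact isModuleRank_dimZero
  · exact isModuleRank_dimPow hO m k

theorem dimZero_quotient {J : Ideal O} (hJ : J ≠ ⊥) : dimZero O (.of O (O ⧸ J)) = 0 := by
  obtain ⟨r, hr, hr0⟩ := Submodule.exists_mem_ne_zero_of_ne_bot hJ
  have : Subsingleton (FractionRing O ⊗[O] (O ⧸ J)) := by
    refine subsingleton_of_forall_eq 0 fun x => ?_
    induction x with
    | zero => rfl
    | add a b ha hb => rw [ha, hb, add_zero]
    | tmul q x =>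
      obtain ⟨x, rfl⟩ := Ideal.Quotient.mk_surjective x
      have hr1 : algebraMap O (FractionRing O) r ≠ 0 := by
        simpa using hr0
      have hq : q = r • (q / algebraMap O (FractionRing O) r) := by
        rw [Algebra.smul_def, mul_div_cancel₀ _ hr1]
      rw [hq, TensorProduct.smul_tmul]
      have : r • Ideal.Quotient.mk J x = 0 :=
        Ideal.Quotient.eq_zero_iff_mem.mpr (J.mul_mem_right x hr)
      rw [this, TensorProduct.tmul_zero]
  exact (isModuleRank_fieldRank (FractionRing O)).of_subsingleton

theorem dimPow_quotient (m : MaximalSpectrum O) (k : ℕ+) (J : Ideal O) :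
    dimPow m k (.of O (O ⧸ J)) =
      ((Module.length O (O ⧸ (m.asIdeal ^ (k : ℕ) ⊔ J))).toNat : ℝ) / k := by
  rw [← length_tensor_quotient]
  rfl

theorem dimPow_quotient_pow_self (hO : ¬ IsField O) (m : MaximalSpectrum O) (k : ℕ+) (j : ℕ) :
    dimPow m k (.of O (O ⧸ m.asIdeal ^ j)) = ((min j k : ℕ) : ℝ) / k := by
  have hm := MaximalSpectrum.asIdeal_ne_bot hO m
  have : m.asIdeal ^ (k : ℕ) ⊔ m.asIdeal ^ j = m.asIdeal ^ (min j k) := by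
    rcases le_total j k with h | h
    · rw [min_eq_left h]
      exact sup_eq_right.mpr (Ideal.pow_le_pow_right h)
    · rw [min_eq_right h]
      exact sup_eq_left.mpr (Ideal.pow_le_pow_right h)
  have := m.isMaximal
  rw [dimPow_quotient, ‹_ ⊔ _ = _›, length_quotient_pow hm, ENat.toNat_natCast]

omit [IsDedekindDomain O] in
theorem MaximalSpectrum.isCoprime_pow {m m' : MaximalSpectrum O} (h : m ≠ m') (k j : ℕ) :
    IsCoprime (m.asIdeal ^ k) (m'.asIdeal ^ j) := by
  refine IsCoprime.pow ?_
  rw [Ideal.isCoprime_iff_sup_eq]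
  exact m.isMaximal.coprime_of_ne m'.isMaximal fun h' => h (MaximalSpectrum.ext h')

theorem dimPow_quotient_pow_of_ne {m m' : MaximalSpectrum O} (h : m ≠ m') (k : ℕ+) (j : ℕ) :
    dimPow m k (.of O (O ⧸ m'.asIdeal ^ j)) = 0 := by
  rw [dimPow_quotient, Ideal.isCoprime_iff_sup_eq.mp (MaximalSpectrum.isCoprime_pow h k j)]
  simp

end Dedekind

section

open Filter Topology

/-! ### Bounded concave sequences -/

section Sequences

/-- Abel summation for second differences. -/
theorem sum_secondDiff_mul_min (a : ℕ → ℝ) (h0 : a 0 = 0) (n N : ℕ) :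
    ∑ j ∈ Finset.range N, (2 * a (j + 1) - a j - a (j + 2)) * ((min n (j + 1) : ℕ) : ℝ) =
      a (min n N) - (min n N : ℕ) * (a (N + 1) - a N) := by
  induction N with
  | zero => simp [h0]
  | succ N ih =>
    rw [Finset.sum_range_succ, ih]
    rcases le_or_gt n N with h | h
    · rw [min_eq_left h, min_eq_left (by omega : n ≤ N + 1)]
      ring
    · rw [min_eq_right h.le, min_eq_right (by omega : N + 1 ≤ n)]
      push_cast
      ring

/-- For `N ≥ n` the partial sum is `a n - n (a (N + 1) - a N)`, and the increments of a bounded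
monotone sequence tend to zero. -/
theorem hasSum_secondDiff_mul_min (a : ℕ → ℝ) (h0 : a 0 = 0) (hmono : Monotone a)
    (hbdd : ∀ n, a n ≤ 1) (hconc : ∀ n, a n + a (n + 2) ≤ 2 * a (n + 1)) (n : ℕ) :
    HasSum (fun j => (2 * a (j + 1) - a j - a (j + 2)) * ((min n (j + 1) : ℕ) : ℝ)) (a n) := by
  rw [hasSum_iff_tendsto_nat_of_nonneg]
  · have hlim : Tendsto a atTop (𝓝 (⨆ i, a i)) :=
      tendsto_atTop_ciSup hmono ⟨1, by rintro _ ⟨i, rfl⟩; exact hbdd i⟩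
    have hdiff : Tendsto (fun N => a n - n * (a (N + 1) - a N)) atTop (𝓝 (a n)) := by
      have := ((hlim.comp (tendsto_add_atTop_nat 1)).sub hlim).const_mul (n : ℝ)
      simpa using this.const_sub (a n)
    refine hdiff.congr' ?_
    filter_upwards [eventually_ge_atTop n] with N hN
    rw [sum_secondDiff_mul_min a h0, min_eq_left hN]
  · intro j
    have := hconc j
    refine mul_nonneg ?_ (Nat.cast_nonneg _)
    linarith

theorem sum_succ_mul_secondDiff_le (a : ℕ → ℝ) (h0 : a 0 = 0) (hmono : Monotone a) (N : ℕ) :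
    ∑ j ∈ Finset.range N, ((j : ℝ) + 1) * (2 * a (j + 1) - a j - a (j + 2)) ≤ a N := by
  have h := sum_secondDiff_mul_min a h0 N N
  rw [min_self] at h
  have h' : ∑ j ∈ Finset.range N, ((j : ℝ) + 1) * (2 * a (j + 1) - a j - a (j + 2)) =
      ∑ j ∈ Finset.range N, (2 * a (j + 1) - a j - a (j + 2)) * ((min N (j + 1) : ℕ) : ℝ) := by
    refine Finset.sum_congr rfl fun j hj => ?_
    rw [min_eq_right (Finset.mem_range.mp hj), mul_comm]
    push_cast
    rfl
  rw [h', h]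
  have : 0 ≤ (N : ℝ) * (a (N + 1) - a N) :=
    mul_nonneg (Nat.cast_nonneg _) (sub_nonneg.mpr (hmono (Nat.le_succ N)))
  linarith

end Sequences

/-! ### Concavity and joint boundedness of `k ↦ d (O ⧸ m ^ k)` -/

section Concavity

variable {O : Type u} [CommRing O] [IsDedekindDomain O] {d : FPModule O → ℝ}

theorem IsModuleRank.quotient_pow_mono (hd : IsModuleRank O d) (m : Ideal O) :
    Monotone fun k => d (.of O (O ⧸ m ^ k)) := fun _ _ h =>
  hd.le_of_surjective (Submodule.factor (Ideal.pow_le_pow_right h))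
    (Submodule.factor_surjective _)

theorem IsModuleRank.quotient_pow_zero (hd : IsModuleRank O d) (m : Ideal O) :
    d (.of O (O ⧸ m ^ 0)) = 0 := by
  have : Subsingleton (O ⧸ m ^ 0) := by
    rw [pow_zero]
    exact Ideal.Quotient.subsingleton_iff.mpr Ideal.one_eq_top
  exact hd.of_subsingleton

/-- Reduction and multiplication by a uniformizer `π` give a right exact sequence `O/m^(k+1) → O/m^k
⊕ O/m^(k+2) → O/m^(k+1) → 0`. -/
theorem IsModuleRank.quotient_pow_concave (hd : IsModuleRank O d) {m : Ideal O} [m.IsMaximal]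
    (hm : m ≠ ⊥) (k : ℕ) :
    d (.of O (O ⧸ m ^ k)) + d (.of O (O ⧸ m ^ (k + 2))) ≤ 2 * d (.of O (O ⧸ m ^ (k + 1))) := by
  obtain ⟨π, hπ, hπ'⟩ := Ideal.exists_mem_pow_notMem_pow_succ m hm (Ideal.IsPrime.ne_top') 1
  rw [pow_one] at hπ
  have hpow : ∀ i, π ^ i ∈ m ^ i := fun i => Ideal.pow_mem_pow hπ i
  have hpow' : ∀ i, π ^ i ∉ m ^ (i + 1) := by
    intro i h
    have hp : Prime m := Ideal.prime_of_isPrime hm inferInstance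
    obtain ⟨J, hJ⟩ := Ideal.dvd_span_singleton.mpr hπ
    rw [← Ideal.dvd_span_singleton, ← Ideal.span_singleton_pow, hJ, mul_pow, pow_succ,
      mul_dvd_mul_iff_left (pow_ne_zero i hm)] at h
    apply hπ'
    rw [← Ideal.dvd_span_singleton, hJ, pow_succ, pow_one]
    exact mul_dvd_mul_left m (hp.dvd_of_dvd_pow h)
  let μ : (O ⧸ m ^ (k + 1)) →ₗ[O] (O ⧸ m ^ (k + 2)) :=
    Submodule.mapQ _ _ (LinearMap.mulLeft O π) (fun x hx => by
      change π * x ∈ m ^ (k + 2)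
      rw [pow_succ' m (k + 1)]
      exact Ideal.mul_mem_mul hπ hx)
  let μ' : (O ⧸ m ^ k) →ₗ[O] (O ⧸ m ^ (k + 1)) :=
    Submodule.mapQ _ _ (LinearMap.mulLeft O π) (fun x hx => by
      change π * x ∈ m ^ (k + 1)
      rw [pow_succ' m k]
      exact Ideal.mul_mem_mul hπ hx)
  let ρ : (O ⧸ m ^ (k + 1)) →ₗ[O] (O ⧸ m ^ k) :=
    Submodule.factor (Ideal.pow_le_pow_right (Nat.le_succ _))
  let ρ' : (O ⧸ m ^ (k + 2)) →ₗ[O] (O ⧸ m ^ (k + 1)) :=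
    Submodule.factor (Ideal.pow_le_pow_right (Nat.le_succ _))
  have hex : Function.Exact (ρ.prod μ)
      (ρ'.coprod (-μ') ∘ₗ (LinearEquiv.prodComm O _ _).toLinearMap) := by
    rintro ⟨b, a⟩
    constructor
    · intro h
      obtain ⟨a, rfl⟩ := Ideal.Quotient.mk_surjective a
      obtain ⟨b, rfl⟩ := Ideal.Quotient.mk_surjective b
      have h : a + -(π * b) ∈ m ^ (k + 1) := Ideal.Quotient.eq_zero_iff_mem.mp h
      -- Since `π ^ (k + 1)` generates `m ^ (k + 1)` modulo `m ^ (k + 2)`, the discrepancy `a - π b`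
      -- is absorbed by correcting `b` with `π ^ k * c`, which vanishes modulo `m ^ k`.
      obtain ⟨c, e, he, hc⟩ := Ideal.exists_mul_add_mem_pow_succ hm (π ^ (k + 1)) _
        (hpow _) (hpow' _) h
      refine ⟨Ideal.Quotient.mk _ (b + π ^ k * c), Prod.ext ?_ ?_⟩
      · refine (Ideal.Quotient.eq).mpr ?_
        change b + π ^ k * c - b ∈ m ^ k
        rw [add_sub_cancel_left]
        exact Ideal.mul_mem_right _ _ (hpow k)
      · refine (Ideal.Quotient.eq).mpr ?_
        have : π * (b + π ^ k * c) - a = -e := by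
          linear_combination hc
        change π * (b + π ^ k * c) - a ∈ _
        rw [this]
        exact neg_mem he
    · rintro ⟨x, hx⟩
      obtain ⟨x, rfl⟩ := Ideal.Quotient.mk_surjective x
      rw [← hx]
      refine Ideal.Quotient.eq_zero_iff_mem.mpr ?_
      change π * x + -(π * x) ∈ _
      rw [add_neg_cancel]
      exact zero_mem _
  have hsurj : Function.Surjective
      (ρ'.coprod (-μ') ∘ₗ (LinearEquiv.prodComm O _ _).toLinearMap) := by
    intro x
    obtain ⟨a, rfl⟩ := Submodule.factor_surjective
      (Ideal.pow_le_pow_right (Nat.le_succ _) : m ^ (k + 2) ≤ m ^ (k + 1)) x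
    exact ⟨(0, a), by simp [ρ']⟩
  have := hd.le_add _ _ hex hsurj
  rw [hd.prod'] at this
  linarith

/-- By coprimality the sum is the rank of one cyclic module. This bound across primes makes the
coefficients summable. -/
theorem IsModuleRank.sum_quotient_pow_le_one (hd : IsModuleRank O d)
    (s : Finset (MaximalSpectrum O)) (n : ℕ) :
    ∑ m ∈ s, d (.of O (O ⧸ m.asIdeal ^ n)) ≤ 1 := by
  suffices d (.of O (O ⧸ ∏ m ∈ s, m.asIdeal ^ n)) = ∑ m ∈ s, d (.of O (O ⧸ m.asIdeal ^ n)) by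
    rw [← this]
    exact hd.quotient_le_one _
  classical
  induction s using Finset.induction_on with
  | empty =>
    have : Subsingleton (O ⧸ ∏ m ∈ (∅ : Finset (MaximalSpectrum O)), m.asIdeal ^ n) :=
      Ideal.Quotient.subsingleton_iff.mpr Ideal.one_eq_top
    rw [hd.of_subsingleton, Finset.sum_empty]
  | insert m s hms ih =>
    rw [Finset.sum_insert hms, Finset.prod_insert hms, hd.quotient_mul, ih]
    refine IsCoprime.prod_right fun m' hm' => MaximalSpectrum.isCoprime_pow ?_ n n
    rintro rfl
    exact hms hm'

end Concavity

end

/-! ### Infinite convex combinations of rank functions -/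

section ConvexCombination

variable {R : Type u} [CommRing R] [IsNoetherianRing R] {ι : Type*} {c : ι → ℝ}
  {D : ι → FPModule R → ℝ}

theorem summable_mul_rank (hc : ∀ i, 0 ≤ c i) (hs : Summable c) (hD : ∀ i, IsModuleRank R (D i))
    (M : FPModule R) : Summable fun i => c i * D i M := by
  obtain ⟨n, hn⟩ := IsModuleRank.exists_forall_le M
  exact Summable.of_nonneg_of_le (fun i => mul_nonneg (hc i) ((hD i).nonneg M))
    (fun i => mul_le_mul_of_nonneg_left (hn _ (hD i)) (hc i)) (hs.mul_right (n : ℝ))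

theorem isModuleRank_tsum (hc : ∀ i, 0 ≤ c i) (hs : HasSum c 1)
    (hD : ∀ i, IsModuleRank R (D i)) : IsModuleRank R fun M => ∑' i, c i * D i M := by
  have hsum := summable_mul_rank hc hs.summable hD
  constructor
  · exact fun M => tsum_nonneg fun i => mul_nonneg (hc i) ((hD i).nonneg M)
  · intro M hM
    simp [(hD _).zero M hM]
  · simp [(hD _).one, hs.tsum_eq]
  · intro M N
    rw [← (hsum M).tsum_add (hsum N)]
    exact tsum_congr fun i => by rw [(hD i).prod, mul_add]
  · intro M₁ M₂ M₃ f g hfg hg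
    rw [← (hsum M₁).tsum_add (hsum M₃)]
    refine (hsum M₂).tsum_le_tsum (fun i => ?_) ((hsum M₁).add (hsum M₃))
    rw [← mul_add]
    exact mul_le_mul_of_nonneg_left ((hD i).le_add_of_exact _ _ _ f g hfg hg) (hc i)
  · intro M₁ M₂ M₃ f g hfg hg
    exact (hsum M₃).tsum_le_tsum
      (fun i => mul_le_mul_of_nonneg_left ((hD i).le_of_exact _ _ _ f g hfg hg) (hc i)) (hsum M₂)

end ConvexCombination

/-! ### Existence and uniqueness of the expansion -/

section Representation

variable {O : Type u} [CommRing O] [IsDedekindDomain O] {d : FPModule O → ℝ}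

/-- The second difference at `k` of the sequence `k ↦ d (O ⧸ m ^ k)`. -/
def secondDiff (d : FPModule O → ℝ) (m : MaximalSpectrum O) (k : ℕ) : ℝ :=
  2 * d (.of O (O ⧸ m.asIdeal ^ (k + 1))) - d (.of O (O ⧸ m.asIdeal ^ k)) -
    d (.of O (O ⧸ m.asIdeal ^ (k + 2)))

theorem IsModuleRank.secondDiff_nonneg (hO : ¬ IsField O) (hd : IsModuleRank O d)
    (m : MaximalSpectrum O) (k : ℕ) : 0 ≤ secondDiff d m k := by
  have := m.isMaximal
  have := hd.quotient_pow_concave (MaximalSpectrum.asIdeal_ne_bot hO m) k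
  unfold secondDiff
  linarith

/-- The coefficient of `dim_{m,k}` in the expansion of `d`. -/
def coeff (d : FPModule O → ℝ) (p : MaximalSpectrum O × ℕ+) : ℝ :=
  p.2 * secondDiff d p.1 p.2.natPred

theorem coeff_succPNat (d : FPModule O → ℝ) (m : MaximalSpectrum O) (k : ℕ) :
    coeff d (m, k.succPNat) = ((k : ℝ) + 1) * secondDiff d m k := by
  simp [coeff]

theorem IsModuleRank.coeff_nonneg (hO : ¬ IsField O) (hd : IsModuleRank O d)
    (p : MaximalSpectrum O × ℕ+) : 0 ≤ coeff d p :=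
  mul_nonneg (Nat.cast_nonneg _) (hd.secondDiff_nonneg hO _ _)

/-- Enlarge `s` to a rectangle of primes times `{1, ..., N}`. Abel summation bounds each row by `d
(O ⧸ m ^ N)`, and these values sum to at most one. -/
theorem IsModuleRank.sum_coeff_le_one (hO : ¬ IsField O) (hd : IsModuleRank O d)
    (s : Finset (MaximalSpectrum O × ℕ+)) : ∑ p ∈ s, coeff d p ≤ 1 := by
  classical
  let N := s.sup fun p => (p.2 : ℕ)
  let t : Finset (MaximalSpectrum O × ℕ+) := s.image Prod.fst ×ˢ (Finset.range N).image Nat.succPNat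
  have hst : s ⊆ t := by
    intro p hp
    refine Finset.mem_product.mpr ⟨Finset.mem_image_of_mem _ hp,
      Finset.mem_image.mpr ⟨p.2.natPred, ?_, PNat.succPNat_natPred _⟩⟩
    have : (p.2 : ℕ) ≤ N := Finset.le_sup (f := fun p : MaximalSpectrum O × ℕ+ => (p.2 : ℕ)) hp
    rw [Finset.mem_range, Nat.lt_iff_add_one_le, PNat.natPred_add_one]
    exact this
  calc ∑ p ∈ s, coeff d p ≤ ∑ p ∈ t, coeff d p :=
        Finset.sum_le_sum_of_subset_of_nonneg hst fun p _ _ => hd.coeff_nonneg hO p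
    _ = ∑ m ∈ s.image Prod.fst, ∑ k ∈ Finset.range N, ((k : ℝ) + 1) * secondDiff d m k := by
        rw [Finset.sum_product]
        refine Finset.sum_congr rfl fun m _ => ?_
        rw [Finset.sum_image fun _ _ _ _ h => Nat.succPNat_injective h]
        exact Finset.sum_congr rfl fun k _ => coeff_succPNat d m k
    _ ≤ ∑ m ∈ s.image Prod.fst, d (.of O (O ⧸ m.asIdeal ^ N)) :=
        Finset.sum_le_sum fun m _ => sum_succ_mul_secondDiff_le
          (fun k => d (.of O (O ⧸ m.asIdeal ^ k))) (hd.quotient_pow_zero _)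
          (hd.quotient_pow_mono _) N
    _ ≤ 1 := hd.sum_quotient_pow_le_one _ N

theorem dimFamily_quotient_pow_of_notMem_range (hO : ¬ IsField O)
    (m : MaximalSpectrum O) (n : ℕ) (i : Option (MaximalSpectrum O × ℕ+))
    (hi : i ∉ Set.range fun k : ℕ => some (m, k.succPNat)) :
    dimFamily O i (.of O (O ⧸ m.asIdeal ^ n)) = 0 := by
  rcases i with _ | ⟨m', k⟩
  · exact dimZero_quotient (pow_ne_zero n (MaximalSpectrum.asIdeal_ne_bot hO m))
  · refine dimPow_quotient_pow_of_ne ?_ k n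
    rintro rfl
    exact hi ⟨k.natPred, by simp⟩

theorem dimFamily_some_succPNat (hO : ¬ IsField O) (m : MaximalSpectrum O) (n k : ℕ) :
    dimFamily O (some (m, k.succPNat)) (.of O (O ⧸ m.asIdeal ^ n)) =
      ((min n (k + 1) : ℕ) : ℝ) / ((k : ℝ) + 1) := by
  refine (dimPow_quotient_pow_self hO m k.succPNat n).trans ?_
  simp

omit [IsDedekindDomain O] in
theorem injective_some_succPNat (m : MaximalSpectrum O) :
    Function.Injective fun k : ℕ => some (m, k.succPNat) := by
  intro k l h
  simpa using h

/-- The sequence `n ↦ min(n, l + 1)` is linear except for a kink at `l + 1`, and the second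
difference indexed by `k` is centred at `k + 1`. All other members of the family vanish on powers of
`m`. -/
theorem secondDiff_dimFamily (hO : ¬ IsField O) (m : MaximalSpectrum O) (k : ℕ)
    (i : Option (MaximalSpectrum O × ℕ+)) (hi : i ≠ some (m, k.succPNat)) :
    secondDiff (dimFamily O i) m k = 0 := by
  by_cases h : i ∈ Set.range fun k : ℕ => some (m, k.succPNat)
  · obtain ⟨l, rfl⟩ := h
    have hl : l ≠ k := by
      rintro rfl
      exact hi rfl
    unfold secondDiff
    rw [dimFamily_some_succPNat hO, dimFamily_some_succPNat hO, dimFamily_some_succPNat hO]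
    rw [← mul_div_assoc, ← sub_div, ← sub_div, div_eq_zero_iff]
    left
    rcases lt_or_gt_of_ne hl with h | h
    · rw [min_eq_right (by omega), min_eq_right (by omega), min_eq_right (by omega)]
      ring
    · rw [min_eq_left (by omega), min_eq_left (by omega), min_eq_left (by omega)]
      push_cast
      ring
  · unfold secondDiff
    rw [dimFamily_quotient_pow_of_notMem_range hO m _ i h,
      dimFamily_quotient_pow_of_notMem_range hO m _ i h,
      dimFamily_quotient_pow_of_notMem_range hO m _ i h]
    ring

theorem secondDiff_dimFamily_self (hO : ¬ IsField O) (m : MaximalSpectrum O) (k : ℕ) :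
    secondDiff (dimFamily O (some (m, k.succPNat))) m k = 1 / ((k : ℝ) + 1) := by
  unfold secondDiff
  rw [dimFamily_some_succPNat hO, dimFamily_some_succPNat hO, dimFamily_some_succPNat hO,
    ← mul_div_assoc, ← sub_div, ← sub_div, min_self, min_eq_left (by omega),
    min_eq_right (by omega)]
  congr 1
  push_cast
  ring

/-- A second difference is a finite linear combination of values, so it passes through the sum and
isolates one term. -/
theorem eq_coeff_of_hasSum (hO : ¬ IsField O) {c : Option (MaximalSpectrum O × ℕ+) → ℝ}
    (h : ∀ M, HasSum (fun i => c i * dimFamily O i M) (d M)) (p : MaximalSpectrum O × ℕ+) :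
    c (some p) = coeff d p := by
  obtain ⟨m, k⟩ := p
  obtain ⟨k, rfl⟩ : ∃ l : ℕ, l.succPNat = k := ⟨k.natPred, PNat.succPNat_natPred k⟩
  have h₁ : HasSum (fun i => c i * secondDiff (dimFamily O i) m k) (secondDiff d m k) := by
    have := (((h (.of O (O ⧸ m.asIdeal ^ (k + 1)))).mul_left 2).sub
      (h (.of O (O ⧸ m.asIdeal ^ k)))).sub (h (.of O (O ⧸ m.asIdeal ^ (k + 2))))
    refine this.congr_fun fun i => ?_
    unfold secondDiff
    ring
  have h₂ := hasSum_single (f := fun i => c i * secondDiff (dimFamily O i) m k)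
    (some (m, k.succPNat)) fun i hi => by
      rw [secondDiff_dimFamily hO m k i hi, mul_zero]
  have h₃ := h₁.unique h₂
  have hk : (k : ℝ) + 1 ≠ 0 := by positivity
  rw [coeff_succPNat, h₃]
  change _ = _ * (_ * secondDiff (dimFamily O (some (m, k.succPNat))) m k)
  rw [secondDiff_dimFamily_self hO]
  field_simp

theorem eq_of_hasSum (hO : ¬ IsField O) {c c' : Option (MaximalSpectrum O × ℕ+) → ℝ}
    (hc : HasSum c 1) (hc' : HasSum c' 1)
    (h : ∀ M, HasSum (fun i => c i * dimFamily O i M) (d M))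
    (h' : ∀ M, HasSum (fun i => c' i * dimFamily O i M) (d M)) : c = c' := by
  have hsome : ∀ p, c (some p) = c' (some p) := fun p => by
    rw [eq_coeff_of_hasSum hO h, eq_coeff_of_hasSum hO h']
  have h₁ := hc.sub hc'
  have h₂ := hasSum_single (f := fun i => c i - c' i) none (by
    rintro (_ | p) hp
    · exact absurd rfl hp
    · rw [hsome, sub_self])
  have h₃ := h₁.unique h₂
  funext i
  rcases i with _ | p
  · linarith
  · exact hsome p

/-- The coefficient of `dim₀` is the mass left by the others. Both sides are then rank functions, so
it suffices to compare them on `O ⧸ m ^ n`, where the claim is the expansion of a concave sequence.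
-/
theorem IsModuleRank.exists_hasSum (hO : ¬ IsField O) (hd : IsModuleRank O d) :
    ∃ c : Option (MaximalSpectrum O × ℕ+) → ℝ, (∀ i, 0 ≤ c i) ∧ HasSum c 1 ∧
      ∀ M, HasSum (fun i => c i * dimFamily O i M) (d M) := by
  have hsum : Summable (coeff d) :=
    summable_of_sum_le (hd.coeff_nonneg hO) (hd.sum_coeff_le_one hO)
  let c : Option (MaximalSpectrum O × ℕ+) → ℝ
    | none => 1 - ∑' p, coeff d p
    | some p => coeff d p
  have hc : ∀ i, 0 ≤ c i := by
    rintro (_ | p)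
    · exact sub_nonneg.mpr (hsum.tsum_le_of_sum_le (hd.sum_coeff_le_one hO))
    · exact hd.coeff_nonneg hO p
  have hc1 : HasSum c 1 := by
    classical
    -- Removing the `none` term leaves a family supported on the image of `some`.
    have h₁ : HasSum (fun i => c i - (Pi.single none (c none) : _ → ℝ) i) (∑' p, coeff d p) := by
      rw [← (Option.some_injective _).hasSum_iff]
      · simpa [Function.comp_def, c] using hsum.hasSum
      · rintro (_ | p) hp
        · simp
        · exact absurd ⟨p, rfl⟩ hp
    have h₂ := h₁.add (hasSum_pi_single (none : Option (MaximalSpectrum O × ℕ+)) (c none))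
    simpa [c] using h₂
  have hD := isModuleRank_dimFamily (O := O) hO
  have hval : (fun M => ∑' i, c i * dimFamily O i M) = d := by
    refine (isModuleRank_tsum hc hc1 hD).ext_of_quotient_pow hd fun m n hm hm0 => ?_
    let m' : MaximalSpectrum O := ⟨m, hm⟩
    have := hasSum_secondDiff_mul_min (fun k => d (.of O (O ⧸ m ^ k))) (hd.quotient_pow_zero _)
      (hd.quotient_pow_mono _) (fun k => hd.quotient_le_one _)
      (fun k => hd.quotient_pow_concave hm0 k) n
    refine HasSum.tsum_eq ?_
    rw [← (injective_some_succPNat m').hasSum_iff]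
    · refine this.congr_fun fun k => ?_
      change coeff d (m', k.succPNat) *
        dimFamily O (some (m', k.succPNat)) (.of O (O ⧸ m'.asIdeal ^ n)) = _
      have hk : (k : ℝ) + 1 ≠ 0 := by positivity
      rw [dimFamily_some_succPNat hO, coeff_succPNat]
      unfold secondDiff
      field_simp
      exact mul_comm _ _
    · intro i hi
      rw [dimFamily_quotient_pow_of_notMem_range hO m' n i hi, mul_zero]
  refine ⟨c, hc, hc1, fun M => ?_⟩
  have := (summable_mul_rank hc hc1.summable hD M).hasSum
  rwa [congrFun hval M] at this

end Representation

/-! ### Extreme points -/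

section Extreme

variable {O : Type u} [CommRing O] [IsDedekindDomain O]

theorem hasSum_single_dimFamily [DecidableEq (Option (MaximalSpectrum O × ℕ+))]
    (i : Option (MaximalSpectrum O × ℕ+)) (M : FPModule O) :
    HasSum (fun j => (Pi.single i (1 : ℝ) : _ → ℝ) j * dimFamily O j M) (dimFamily O i M) := by
  have := hasSum_single (f := fun j => (Pi.single i (1 : ℝ) : _ → ℝ) j * dimFamily O j M) i (by
    intro j hj
    rw [Pi.single_eq_of_ne hj, zero_mul])
  simpa using this

/-- By uniqueness the coefficients of `x₁` and `x₂` average to a point mass; being non-negative,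
those of `x₁` vanish away from `i`. -/
theorem dimFamily_mem_extremePoints (hO : ¬ IsField O) (i : Option (MaximalSpectrum O × ℕ+)) :
    dimFamily O i ∈ (rankSpace O).extremePoints ℝ := by
  classical
  rw [mem_extremePoints_iff_left]
  refine ⟨isModuleRank_dimFamily hO i, ?_⟩
  rintro x₁ hx₁ x₂ hx₂ ⟨a, b, ha, hb, hab, hx⟩
  obtain ⟨c₁, h₁, hs₁, hM₁⟩ := IsModuleRank.exists_hasSum hO hx₁
  obtain ⟨c₂, h₂, hs₂, hM₂⟩ := IsModuleRank.exists_hasSum hO hx₂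
  have hc : (fun j => a * c₁ j + b * c₂ j) = Pi.single i 1 := by
    refine eq_of_hasSum (d := dimFamily O i) hO ?_ (hasSum_pi_single i 1) (fun M => ?_)
      (hasSum_single_dimFamily i)
    · have := (hs₁.mul_left a).add (hs₂.mul_left b)
      rwa [mul_one, mul_one, hab] at this
    · have := ((hM₁ M).mul_left a).add ((hM₂ M).mul_left b)
      rw [← hx]
      exact this.congr_fun fun j => by ring
  have hj : ∀ j, j ≠ i → c₁ j = 0 := by
    intro j hj
    have h := congrFun hc j
    rw [Pi.single_eq_of_ne hj] at h
    have h' : 0 ≤ a * c₁ j := mul_nonneg ha.le (h₁ j)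
    have h'' : 0 ≤ b * c₂ j := mul_nonneg hb.le (h₂ j)
    exact (mul_eq_zero.mp (by linarith : a * c₁ j = 0)).resolve_left ha.ne'
  have hi : c₁ i = 1 := (hasSum_single i hj).unique hs₁
  funext M
  rw [(hM₁ M).unique (hasSum_single i fun j hji => by rw [hj j hji, zero_mul]), hi, one_mul]

/-- Take `i` with `c i > 0`. If `c i = 1`, nothing else remains; otherwise `d` lies strictly between
`dimFamily O i` and the renormalized remainder, and extremality identifies `d` with the former. -/
theorem exists_eq_dimFamily_of_mem_extremePoints (hO : ¬ IsField O) {d : FPModule O → ℝ}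
    (h : d ∈ (rankSpace O).extremePoints ℝ) : ∃ i, dimFamily O i = d := by
  classical
  rw [mem_extremePoints_iff_left] at h
  obtain ⟨hd, hext⟩ := h
  obtain ⟨c, hc, hs, hM⟩ := IsModuleRank.exists_hasSum hO hd
  obtain ⟨i, hi⟩ : ∃ i, 0 < c i := by
    by_contra! hcon
    have h0 : c = fun _ => 0 := funext fun i => le_antisymm (hcon i) (hc i)
    rw [h0] at hs
    exact zero_ne_one (hasSum_zero.unique hs)
  refine ⟨i, ?_⟩
  have hi1 : c i ≤ 1 := le_hasSum hs i fun j _ => hc j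
  have hrest : HasSum (fun j => c j - (Pi.single i (c i) : _ → ℝ) j) (1 - c i) :=
    hs.sub (hasSum_pi_single i (c i))
  have hnn : ∀ j, 0 ≤ c j - (Pi.single i (c i) : _ → ℝ) j := by
    intro j
    rcases eq_or_ne j i with rfl | hj
    · simp
    · rw [Pi.single_eq_of_ne hj, sub_zero]
      exact hc j
  rcases hi1.eq_or_lt with h1 | h1
  · rw [h1] at hnn
    rw [h1, sub_self, hasSum_zero_iff_of_nonneg hnn] at hrest
    have hc' : c = Pi.single i 1 := by
      funext j
      have := congrFun hrest j
      rw [Pi.zero_apply] at this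
      linarith
    funext M
    refine (hasSum_single_dimFamily i M).unique ?_
    rw [← hc']
    exact hM M
  · have hpos : 0 < 1 - c i := sub_pos.mpr h1
    let c' : Option (MaximalSpectrum O × ℕ+) → ℝ := fun j =>
      (c j - (Pi.single i (c i) : _ → ℝ) j) / (1 - c i)
    have hc' : ∀ j, 0 ≤ c' j := fun j => div_nonneg (hnn j) hpos.le
    have hs' : HasSum c' 1 := by
      have := hrest.div_const (1 - c i)
      rwa [div_self hpos.ne'] at this
    have hD := isModuleRank_dimFamily (O := O) hO
    refine hext _ (hD i) _ (isModuleRank_tsum hc' hs' hD)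
      ⟨c i, 1 - c i, hi, hpos, by ring, ?_⟩
    funext M
    have h₁ := ((summable_mul_rank hc' hs'.summable hD M).hasSum.mul_left (1 - c i)).add
      ((hasSum_single_dimFamily i M).mul_left (c i))
    rw [Pi.add_apply, Pi.smul_apply, Pi.smul_apply, smul_eq_mul, smul_eq_mul, add_comm]
    refine h₁.unique ((hM M).congr_fun fun j => ?_)
    have h2 : (Pi.single i (c i) : _ → ℝ) j = c i * (Pi.single i 1 : _ → ℝ) j := by
      rcases eq_or_ne j i with rfl | hj
      · simp
      · simp [hj]
    simp only [c', h2]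
    field_simp
    ring

theorem extremePoints_rankSpace (hO : ¬ IsField O) :
    (rankSpace O).extremePoints ℝ = Set.range (dimFamily O) := by
  ext d
  constructor
  · exact exists_eq_dimFamily_of_mem_extremePoints hO
  · rintro ⟨i, rfl⟩
    exact dimFamily_mem_extremePoints hO i

end Extreme

/-! ### Coefficient fields -/

section CoefficientField

open Polynomial in
/-- In characteristic `p`, a surjection onto a field with square-zero kernel has a section. -/
theorem exists_section_of_charP (p : ℕ) [Fact p.Prime] {B K : Type*} [CommRing B] [Field K]
    [CharP B p] [CharP K p] (π : B →+* K) (hπ : Function.Surjective π)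
    (hker : ∀ x y, π x = 0 → π y = 0 → x * y = 0) :
    ∃ s : K →+* B, ∀ x, π (s x) = x := by
  have hp : p.Prime := Fact.out
  -- Good subrings contain all `p`-th powers and meet the kernel in zero. The `p`-th powers
  -- themselves form one, since `p ≥ 2` kills the square-zero kernel. A maximal one will map
  -- isomorphically to `K`.
  let Good : Set (Subring B) := {E | (∀ b : B, b ^ p ∈ E) ∧ ∀ x ∈ E, π x = 0 → x = 0}
  obtain ⟨E, hE⟩ : ∃ E, Maximal (· ∈ Good) E := by
    refine zorn_le_nonempty₀ Good ?_ (frobenius B p).range ?_ |>.imp fun E h => h.2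
    · intro C hC hchain E₀ hE₀
      refine ⟨sSup C, ⟨fun b => ?_, fun x hx hx0 => ?_⟩, fun E hE => le_sSup hE⟩
      · exact (le_sSup hE₀ : E₀ ≤ sSup C) ((hC hE₀).1 b)
      · obtain ⟨E, hE, hxE⟩ := (Subring.mem_sSup_of_directedOn ⟨E₀, hE₀⟩ hchain.directedOn).mp hx
        exact (hC hE).2 x hxE hx0
    · refine ⟨fun b => ⟨b, rfl⟩, ?_⟩
      rintro _ ⟨b, rfl⟩ hb
      rw [frobenius_def] at hb ⊢
      rw [map_pow] at hb
      have hb0 : π b = 0 := pow_eq_zero_iff hp.ne_zero |>.mp hb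
      obtain ⟨q, hq⟩ := Nat.exists_eq_add_of_le hp.two_le
      rw [hq, pow_add, pow_two, hker b b hb0 hb0, zero_mul]
  obtain ⟨hpow, hinj⟩ := hE.prop
  -- the image of `E` is a subfield
  let F : Subfield K :=
    { E.map π with
      inv_mem' := by
        rintro _ ⟨x, hx, rfl⟩
        by_cases h0 : π x = 0
        · rw [h0, inv_zero]
          exact (E.map π).zero_mem
        · obtain ⟨y, hy⟩ := hπ (π x)⁻¹
          -- As `y` lifts the inverse of `π x`, this maps to `(π x) ^ (p - 1) * (π x) ^ (-p)`, and
          -- `y ^ p` lies in `E` although `y` need not.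
          refine ⟨x ^ (p - 1) * y ^ p, E.mul_mem (E.pow_mem hx _) (hpow y), ?_⟩
          rw [map_mul, map_pow, map_pow, hy, inv_pow]
          obtain ⟨q, hq⟩ := Nat.exists_eq_add_of_le hp.one_le
          rw [hq, add_tsub_cancel_left, pow_add, pow_one]
          field_simp }
  have hF : ∀ x, x ∈ F ↔ ∃ y ∈ E, π y = x := fun x => Iff.rfl
  have hsurj : ∀ x : K, ∃ y ∈ E, π y = x := by
    intro x
    by_contra hx
    rw [← hF] at hx
    obtain ⟨a, rfl⟩ := hπ x
    let φ : E →+* F := (π.comp E.subtype).codRestrict F.toSubring fun y => ⟨y, y.2, rfl⟩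
    have hφ : Function.Injective φ := (injective_iff_map_eq_zero _).mpr fun y hy =>
      Subtype.ext (hinj y y.2 (congrArg Subtype.val hy))
    have := φ.domain_nontrivial
    let ap : E := ⟨a ^ p, hpow a⟩
    -- Irreducible because a `p`-th root of `π a ^ p` in `F` would equal `π a`, by injectivity of
    -- Frobenius.
    have hmin : minpoly F (π a) = X ^ p - C (φ ap) := by
      refine (minpoly.eq_of_irreducible_of_monic
        (X_pow_sub_C_irreducible_of_prime hp fun b hb => hx ?_) ?_
        (monic_X_pow_sub_C _ hp.ne_zero)).symm
      · have h : (b : K) ^ p = π a ^ p := by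
          rw [← map_pow]
          exact congrArg Subtype.val hb
        have h' : (b : K) = π a := frobenius_inj K p h
        rw [← h']
        exact b.2
      · rw [map_sub, map_pow, aeval_X, aeval_C, sub_eq_zero, ← map_pow]
        rfl
    let ev : E[X] →+* B := eval₂RingHom E.subtype a
    have hg : ev (X ^ p - C ap) = 0 := by
      simp [ev, ap]
    have hmon : (X ^ p - C ap).Monic := monic_X_pow_sub_C _ hp.ne_zero
    have hle : E ≤ ev.range := fun y hy => ⟨C ⟨y, hy⟩, by simp [ev]⟩
    -- Adjoining `a` keeps the subring good: its elements are `f(a)` with `deg f < p`, and a nonzero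
    -- such `f` cannot vanish at `π a`. Maximality of `E` then puts `a` in `E`.
    have hgood : ev.range ∈ Good := by
      refine ⟨fun b => hle (hpow b), ?_⟩
      rintro _ ⟨f, rfl⟩ hf
      have hfr : ev f = ev (f %ₘ (X ^ p - C ap)) := by
        conv_lhs => rw [← modByMonic_add_div f (X ^ p - C ap)]
        rw [map_add, map_mul, hg, zero_mul, add_zero]
      rw [hfr] at hf ⊢
      suffices h : f %ₘ (X ^ p - C ap) = 0 by rw [h, map_zero]
      by_contra hr
      have hr' : (f %ₘ (X ^ p - C ap)).map φ ≠ 0 :=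
        (Polynomial.map_ne_zero_iff hφ).mpr hr
      have hroot : aeval (π a) ((f %ₘ (X ^ p - C ap)).map φ) = 0 := by
        rw [aeval_def, eval₂_map, ← hf]
        exact (hom_eval₂ _ E.subtype π a).symm
      have hdeg := minpoly.degree_le_of_ne_zero F (π a) hr' hroot
      rw [hmin, degree_X_pow_sub_C hp.pos, degree_map_eq_of_injective hφ] at hdeg
      have := degree_modByMonic_lt f hmon
      rw [degree_X_pow_sub_C hp.pos] at this
      exact absurd this (not_lt.mpr hdeg)
    exact hx ⟨a, hE.le_of_ge hgood hle ⟨X, by simp [ev]⟩, rfl⟩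
  let ε : E →+* K := π.comp E.subtype
  have hε : Function.Bijective ε := by
    refine ⟨(injective_iff_map_eq_zero _).mpr fun x hx => Subtype.ext (hinj x x.2 hx), fun x => ?_⟩
    obtain ⟨y, hy, rfl⟩ := hsurj x
    exact ⟨⟨y, hy⟩, rfl⟩
  let e := RingEquiv.ofBijective ε hε
  exact ⟨E.subtype.comp e.symm.toRingHom, fun x => e.apply_symm_apply x⟩

/-- Lifting `f : L → B ⧸ I` with `I` square-zero amounts to a section of the projection from the
fibre product of `B` and `L` over `B ⧸ I` to `L`, whose kernel is again square-zero. -/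
theorem formallySmooth_zmod (p : ℕ) [Fact p.Prime] (L : Type*) [Field L] [Algebra (ZMod p) L] :
    Algebra.FormallySmooth (ZMod p) L := by
  rw [Algebra.FormallySmooth.iff_comp_surjective]
  intro B _ _ I hI f
  let S : Subalgebra (ZMod p) (B × L) := AlgHom.equalizer
    ((Ideal.Quotient.mkₐ (ZMod p) I).comp (AlgHom.fst (ZMod p) B L))
    (f.comp (AlgHom.snd (ZMod p) B L))
  have hS : ∀ x : S, Ideal.Quotient.mk I x.1.1 = f x.1.2 := fun x => x.2
  let π : S →+* L := (RingHom.snd B L).comp S.subtype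
  have hπ : Function.Surjective π := fun x => by
    obtain ⟨b, hb⟩ := Ideal.Quotient.mk_surjective (f x)
    exact ⟨⟨(b, x), hb⟩, rfl⟩
  have := π.domain_nontrivial
  have : CharP S p := charP_of_injective_algebraMap (algebraMap (ZMod p) S).injective p
  have : CharP L p := charP_of_injective_algebraMap (algebraMap (ZMod p) L).injective p
  obtain ⟨s, hs⟩ := exists_section_of_charP p π hπ (by
    intro x y hx hy
    have hx' : x.1.2 = 0 := hx
    have hy' : y.1.2 = 0 := hy
    have hxI : x.1.1 ∈ I := by rw [← Ideal.Quotient.eq_zero_iff_mem, hS, hx', map_zero]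
    have hyI : y.1.1 ∈ I := by rw [← Ideal.Quotient.eq_zero_iff_mem, hS, hy', map_zero]
    have hmul := Ideal.mul_mem_mul hxI hyI
    rw [← pow_two, hI, Ideal.mem_bot] at hmul
    refine Subtype.ext (Prod.ext hmul ?_)
    change x.1.2 * y.1.2 = 0
    rw [hx', zero_mul])
  let g : L →+* B := (RingHom.fst B L).comp (S.subtype.comp s)
  refine ⟨{ g with commutes' := fun r => ?_ }, ?_⟩
  · exact RingHom.congr_fun (Subsingleton.elim (g.comp (algebraMap (ZMod p) L))
      (algebraMap (ZMod p) B)) r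
  · ext x
    exact (hS (s x)).trans (congrArg f (hs x))

/-- In characteristic zero `L` is separable algebraic over a purely transcendental extension. -/
theorem formallySmooth_rat (L : Type*) [Field L] [Algebra ℚ L] : Algebra.FormallySmooth ℚ L := by
  obtain ⟨s, hs⟩ := exists_isTranscendenceBasis ℚ L
  have := hs.isAlgebraic_field
  exact Algebra.FormallySmooth.of_algebraicIndependent_of_isSeparable hs.1

theorem isNilpotent_ker_factor_pow {R : Type*} [CommRing R] (I : Ideal R) (k : ℕ) (hk : k ≠ 0) :
    IsNilpotent (RingHom.ker (Ideal.Quotient.factor (Ideal.pow_le_self hk : I ^ k ≤ I))) := by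
  refine ⟨k, ?_⟩
  rw [Ideal.Quotient.factor_ker, ← Ideal.map_pow, Ideal.map_quotient_self, Ideal.zero_eq_bot]

theorem exists_section_of_formallySmooth (F : Type*) [Field F] {O : Type*} [CommRing O]
    [Algebra F O] (m : Ideal O) [m.IsMaximal] (k : ℕ) (hk : k ≠ 0)
    (h : Algebra.FormallySmooth F (O ⧸ m)) :
    ∃ s : O ⧸ m →+* O ⧸ m ^ k, ∀ x, Ideal.Quotient.factor (Ideal.pow_le_self hk) (s x) = x := by
  let g : (O ⧸ m ^ k) →ₐ[F] (O ⧸ m) := Ideal.Quotient.factorₐ F (Ideal.pow_le_self hk)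
  have hg : Function.Surjective g := Ideal.Quotient.factor_surjective (Ideal.pow_le_self hk)
  have hnil : IsNilpotent (RingHom.ker g) := isNilpotent_ker_factor_pow m k hk
  let s := Algebra.FormallySmooth.liftOfSurjective (AlgHom.id F (O ⧸ m)) g hg hnil
  exact ⟨s, fun x => Algebra.FormallySmooth.liftOfSurjective_apply (AlgHom.id F (O ⧸ m)) g hg hnil x⟩

/-- The quotients `O ⧸ m ^ k` of a ring containing a field have a coefficient field. -/
theorem exists_section_quotient_pow {O : Type*} [CommRing O] (hO : ∃ F : Subring O, IsField F)
    (m : Ideal O) [m.IsMaximal] (k : ℕ) (hk : k ≠ 0) :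
    ∃ s : O ⧸ m →+* O ⧸ m ^ k, ∀ x, Ideal.Quotient.factor (Ideal.pow_le_self hk) (s x) = x := by
  obtain ⟨F, hF⟩ := hO
  let _ : Field F := hF.toField
  let _ : Field (O ⧸ m) := Ideal.Quotient.field m
  -- Only the prime field of `F` is used, as the base for formal smoothness of `O ⧸ m`.
  obtain ⟨p, hp⟩ := CharP.exists F
  rcases CharP.char_is_prime_or_zero F p with hp' | rfl
  · have : Fact p.Prime := ⟨hp'⟩
    let _ : Algebra (ZMod p) F := ZMod.algebra F p
    let _ : Algebra (ZMod p) O := (F.subtype.comp (algebraMap (ZMod p) F)).toAlgebra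
    exact exists_section_of_formallySmooth (ZMod p) m k hk (formallySmooth_zmod p _)
  · have : CharZero F := CharP.charP_to_charZero F
    let _ : Algebra ℚ O := (F.subtype.comp (algebraMap ℚ F)).toAlgebra
    exact exists_section_of_formallySmooth ℚ m k hk (formallySmooth_rat _)

end CoefficientField

section

open Module MulOpposite

/-! ### The rank function on endomorphisms of a vector space -/

section EndRank

variable (K V : Type*) [Field K] [AddCommGroup V] [Module K V]

/-- A quasi-inverse of `x` is a projection onto the range of `x` followed by a linear section of
`x`. -/
theorem isVonNeumannRegular_end (K V : Type u) [Field K] [AddCommGroup V] [Module K V] :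
    IsVonNeumannRegular (End K V)ᵐᵒᵖ := by
  intro x
  obtain ⟨s, hs⟩ := LinearMap.exists_rightInverse_of_surjective x.unop.rangeRestrict
    x.unop.range_rangeRestrict
  obtain ⟨p, hp⟩ := LinearMap.exists_leftInverse_of_injective
    (LinearMap.range x.unop).subtype (Submodule.ker_subtype _)
  refine ⟨op (s ∘ₗ p), unop_injective (LinearMap.ext fun v => ?_)⟩
  have h₁ : p (x.unop v) = x.unop.rangeRestrict v := LinearMap.congr_fun hp (x.unop.rangeRestrict v)
  have h₂ : x.unop.rangeRestrict (s (x.unop.rangeRestrict v)) = x.unop.rangeRestrict v :=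
    LinearMap.congr_fun hs _
  change x.unop (s (p (x.unop v))) = x.unop v
  rw [h₁]
  exact congrArg Subtype.val h₂

variable {K V}

/-- A matrix over the opposite of `End K V` acts on row vectors with entries in `V`. -/
def rowAction {n m : ℕ} (B : Matrix (Fin n) (Fin m) (End K V)ᵐᵒᵖ) :
    (Fin n → V) →ₗ[K] (Fin m → V) :=
  LinearMap.pi fun j => ∑ i, (B i j).unop ∘ₗ LinearMap.proj i

theorem rowAction_apply {n m : ℕ} (B : Matrix (Fin n) (Fin m) (End K V)ᵐᵒᵖ) (v : Fin n → V)
    (j : Fin m) : rowAction B v j = ∑ i, (B i j).unop (v i) := by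
  simp [rowAction]

theorem rowAction_mul {n m l : ℕ} (A : Matrix (Fin n) (Fin m) (End K V)ᵐᵒᵖ)
    (B : Matrix (Fin m) (Fin l) (End K V)ᵐᵒᵖ) :
    rowAction (A * B) = rowAction B ∘ₗ rowAction A := by
  refine LinearMap.ext fun v => funext fun j => ?_
  simp only [rowAction_apply, LinearMap.comp_apply, Matrix.mul_apply, Finset.unop_sum, unop_mul,
    LinearMap.sum_apply, map_sum, End.mul_apply]
  exact Finset.sum_comm

variable (K V) in
/-- Splitting a row vector into two blocks. -/
def splitRow (n k : ℕ) : (Fin (n + k) → V) ≃ₗ[K] (Fin n → V) × (Fin k → V) :=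
  (LinearEquiv.funCongrLeft K V finSumFinEquiv).trans
    (LinearEquiv.sumArrowLequivProdArrow (Fin n) (Fin k) K V)

theorem splitRow_rowAction {n m k l : ℕ} (A : Matrix (Fin n) (Fin m) (End K V)ᵐᵒᵖ)
    (C : Matrix (Fin n) (Fin l) (End K V)ᵐᵒᵖ) (B : Matrix (Fin k) (Fin l) (End K V)ᵐᵒᵖ)
    (v : Fin (n + k) → V) :
    splitRow K V m l (rowAction (blockUpper A C B) v) =
      (rowAction A (splitRow K V n k v).1,
        rowAction C (splitRow K V n k v).1 + rowAction B (splitRow K V n k v).2) := by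
  have h₁ : ∀ i, (splitRow K V n k v).1 i = v (finSumFinEquiv (Sum.inl i)) := fun i => rfl
  have h₂ : ∀ i, (splitRow K V n k v).2 i = v (finSumFinEquiv (Sum.inr i)) := fun i => rfl
  refine Prod.ext (funext fun j => ?_) (funext fun j => ?_)
  · change rowAction (blockUpper A C B) v (finSumFinEquiv (Sum.inl j)) = _
    dsimp only
    rw [rowAction_apply, ← finSumFinEquiv.sum_comp, Fintype.sum_sum_type, rowAction_apply]
    simp [blockUpper, h₁]
  · change rowAction (blockUpper A C B) v (finSumFinEquiv (Sum.inr j)) = _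
    dsimp only
    rw [rowAction_apply, ← finSumFinEquiv.sum_comp, Fintype.sum_sum_type, Pi.add_apply,
      rowAction_apply, rowAction_apply]
    simp [blockUpper, h₁, h₂]

variable (K V) in
/-- The normalized rank of the action of a matrix on row vectors with entries in `V`. -/
def endRank (n m : ℕ) (B : Matrix (Fin n) (Fin m) (End K V)ᵐᵒᵖ) : ℝ :=
  (finrank K (LinearMap.range (rowAction B)) : ℝ) / finrank K V

variable [FiniteDimensional K V]

/-- Rank-nullity for the projection of the range to the first block: its image contains the range of
`A`, and its kernel maps onto a space containing the range of `B`. -/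
theorem finrank_range_rowAction_blockUpper {n m k l : ℕ}
    (A : Matrix (Fin n) (Fin m) (End K V)ᵐᵒᵖ)
    (C : Matrix (Fin n) (Fin l) (End K V)ᵐᵒᵖ) (B : Matrix (Fin k) (Fin l) (End K V)ᵐᵒᵖ) :
    finrank K (LinearMap.range (rowAction A)) + finrank K (LinearMap.range (rowAction B)) ≤
      finrank K (LinearMap.range (rowAction (blockUpper A C B))) := by
  let W := LinearMap.range (rowAction (blockUpper A C B))
  let f : W →ₗ[K] (Fin m → V) :=
    LinearMap.fst K _ _ ∘ₗ (splitRow K V m l).toLinearMap ∘ₗ W.subtype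
  have hf : LinearMap.range (rowAction A) ≤ LinearMap.range f := by
    rintro _ ⟨v, rfl⟩
    refine ⟨⟨_, (splitRow K V n k).symm (v, 0), rfl⟩, ?_⟩
    change (splitRow K V m l (rowAction (blockUpper A C B) _)).1 = _
    rw [splitRow_rowAction, LinearEquiv.apply_symm_apply]
  let g : LinearMap.ker f →ₗ[K] (Fin l → V) :=
    LinearMap.snd K _ _ ∘ₗ (splitRow K V m l).toLinearMap ∘ₗ W.subtype ∘ₗ (LinearMap.ker f).subtype
  have hg : LinearMap.range (rowAction B) ≤ LinearMap.range g := by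
    rintro _ ⟨v, rfl⟩
    refine ⟨⟨⟨_, (splitRow K V n k).symm (0, v), rfl⟩, ?_⟩, ?_⟩
    · change (splitRow K V m l (rowAction (blockUpper A C B) _)).1 = _
      rw [splitRow_rowAction, LinearEquiv.apply_symm_apply, map_zero]
    · change (splitRow K V m l (rowAction (blockUpper A C B) _)).2 = _
      rw [splitRow_rowAction, LinearEquiv.apply_symm_apply]
      simp
  rw [← f.finrank_range_add_finrank_ker]
  exact add_le_add (Submodule.finrank_mono hf)
    ((Submodule.finrank_mono hg).trans (LinearMap.finrank_range_le g))

theorem finrank_range_rowAction_diag {n m k l : ℕ}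
    (A : Matrix (Fin n) (Fin m) (End K V)ᵐᵒᵖ) (B : Matrix (Fin k) (Fin l) (End K V)ᵐᵒᵖ) :
    finrank K (LinearMap.range (rowAction (blockUpper A 0 B))) ≤
      finrank K (LinearMap.range (rowAction A)) + finrank K (LinearMap.range (rowAction B)) := by
  let f : LinearMap.range (rowAction A) × LinearMap.range (rowAction B) →ₗ[K] (Fin (m + l) → V) :=
    (splitRow K V m l).symm.toLinearMap ∘ₗ
      (LinearMap.range (rowAction A)).subtype.prodMap (LinearMap.range (rowAction B)).subtype
  rw [← finrank_prod]
  refine (Submodule.finrank_mono ?_).trans (LinearMap.finrank_range_le f)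
  rintro _ ⟨v, rfl⟩
  refine ⟨(⟨_, (splitRow K V n k v).1, rfl⟩, ⟨_, (splitRow K V n k v).2, rfl⟩), ?_⟩
  apply (splitRow K V m l).injective
  change splitRow K V m l ((splitRow K V m l).symm _) = _
  rw [LinearEquiv.apply_symm_apply, splitRow_rowAction]
  refine Prod.ext rfl ?_
  have h0 : rowAction (0 : Matrix (Fin n) (Fin l) (End K V)ᵐᵒᵖ) (splitRow K V n k v).1 = 0 :=
    funext fun j => by simp [rowAction_apply]
  rw [h0, zero_add]
  rfl

theorem endRank_le (n m : ℕ) (B : Matrix (Fin n) (Fin m) (End K V)ᵐᵒᵖ) : endRank K V n m B ≤ m := by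
  refine div_le_of_le_mul₀ (Nat.cast_nonneg _) (Nat.cast_nonneg _) ?_
  have h := Submodule.finrank_le (LinearMap.range (rowAction B))
  rw [finrank_pi_fintype, Finset.sum_const, Finset.card_univ, Fintype.card_fin, smul_eq_mul] at h
  exact_mod_cast h

end EndRank

theorem isMatrixRank_endRank (K V : Type u) [Field K] [AddCommGroup V] [Module K V]
    [FiniteDimensional K V] [Nontrivial V] : IsMatrixRank (End K V)ᵐᵒᵖ (endRank K V) := by
  have hV : (0 : ℝ) < finrank K V := by exact_mod_cast finrank_pos
  constructor
  · intro n m A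
    unfold endRank
    positivity
  · intro n m
    have h0 : rowAction (0 : Matrix (Fin n) (Fin m) (End K V)ᵐᵒᵖ) = 0 :=
      LinearMap.ext fun v => funext fun j => by simp [rowAction_apply]
    simp [endRank, h0]
  · have h1 : rowAction (1 : Matrix (Fin 1) (Fin 1) (End K V)ᵐᵒᵖ) = LinearMap.id :=
      LinearMap.ext fun v => funext fun j => by
        rw [rowAction_apply, Fin.sum_univ_one, Subsingleton.elim j 0]
        simp
    unfold endRank
    rw [h1, LinearMap.range_id, finrank_top, finrank_pi_fintype, Fin.sum_univ_one,
      div_self hV.ne']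
  · intro n m l A B
    unfold endRank
    rw [rowAction_mul, le_min_iff]
    refine ⟨div_le_div_of_nonneg_right ?_ hV.le, div_le_div_of_nonneg_right ?_ hV.le⟩
    · rw [LinearMap.range_comp]
      exact_mod_cast Submodule.finrank_map_le _ _
    · exact_mod_cast Submodule.finrank_mono (LinearMap.range_comp_le_range _ _)
  · intro n m k l A B
    unfold endRank
    rw [← add_div]
    congr 1
    exact_mod_cast le_antisymm (finrank_range_rowAction_diag A B)
      (finrank_range_rowAction_blockUpper A 0 B)
  · intro n m k l A C B
    unfold endRank
    rw [← add_div]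
    refine div_le_div_of_nonneg_right ?_ hV.le
    exact_mod_cast finrank_range_rowAction_blockUpper A C B

/-! ### Matrix ranks from a module `V` -/

section Comparison

variable {O K V : Type u} [CommRing O] [Field K] [AddCommGroup V] [Module O V] [Module K V]
  [SMulCommClass O K V]

variable (O K V) in
/-- The action of `O` on `V`, as a homomorphism to the opposite of `End K V`. -/
def scalarHom : O →+* (End K V)ᵐᵒᵖ :=
  (Module.toModuleEnd K V).toOpposite fun x y => (Commute.all x y).map (Module.toModuleEnd K V)

theorem unop_scalarHom_apply (r : O) (v : V) : (scalarHom O K V r).unop v = r • v := rfl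

/-- Tensor the presentation `Oⁿ → Oᵐ → Oᵐ / Oⁿ A → 0` with `V`. The identifications `V ⊗ Oⁿ ≅ Vⁿ`
used here are only `O`-linear, so `g` is written out to be `K`-linear and then compared with the
tensored map. -/
theorem exists_exact_rowAction {n m : ℕ} (A : Matrix (Fin n) (Fin m) O) :
    ∃ g : (Fin m → V) →ₗ[K] V ⊗[O] ((Fin m → O) ⧸ rowSpan A), Function.Surjective g ∧
      LinearMap.ker g = LinearMap.range (rowAction (A.map (scalarHom O K V))) := by
  let q := (rowSpan A).mkQ
  let τ : ((Fin m → O) ⧸ rowSpan A) → V →ₗ[K] V ⊗[O] ((Fin m → O) ⧸ rowSpan A) := fun c =>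
    { toFun := fun v => v ⊗ₜ c
      map_add' := fun v w => TensorProduct.add_tmul v w c
      map_smul' := fun x v => (TensorProduct.smul_tmul' x v c).symm }
  let g : (Fin m → V) →ₗ[K] V ⊗[O] ((Fin m → O) ⧸ rowSpan A) :=
    ∑ j, τ (q (Pi.single j 1)) ∘ₗ LinearMap.proj j
  have hg : ∀ v, g v = ∑ j, v j ⊗ₜ[O] q (Pi.single j 1) := fun v => by simp [g, τ]
  let E : ∀ n, V ⊗[O] (Fin n → O) ≃ₗ[O] (Fin n → V) := fun n =>
    TensorProduct.piScalarRight O O V (Fin n)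
  have hE : ∀ n (v : V) (f : Fin n → O) j, E n (v ⊗ₜ f) j = f j • v := fun n v f j => by
    simp [E, TensorProduct.piScalarRight_apply]
  have hgE : ∀ x, g (E m x) = q.lTensor V x := by
    intro x
    induction x with
    | zero => simp
    | add x y hx hy => rw [map_add, map_add, map_add, hx, hy]
    | tmul v f =>
      rw [hg, LinearMap.lTensor_tmul]
      conv_rhs => rw [pi_eq_sum_univ' f]
      rw [map_sum, TensorProduct.tmul_sum]
      refine Finset.sum_congr rfl fun j _ => ?_
      rw [hE, TensorProduct.smul_tmul, ← map_smul]
  let t : (Fin n → O) →ₗ[O] (Fin m → O) := Matrix.vecMulLinear A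
  have ht : LinearMap.range t = rowSpan A := by
    refine le_antisymm ?_ (Submodule.span_le.mpr ?_)
    · rintro _ ⟨v, rfl⟩
      rw [Matrix.vecMulLinear_apply, Matrix.vecMul_eq_sum]
      exact sum_mem fun i _ => Submodule.smul_mem _ _ (Submodule.subset_span ⟨i, rfl⟩)
    · rintro _ ⟨i, rfl⟩
      exact ⟨Pi.single i 1, Matrix.single_one_vecMul i A⟩
  have htE : ∀ x, E m (t.lTensor V x) = rowAction (A.map (scalarHom O K V)) (E n x) := by
    intro x
    induction x with
    | zero => simp
    | add x y hx hy => rw [map_add, map_add, map_add, hx, hy, map_add]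
    | tmul v f =>
      funext j
      rw [LinearMap.lTensor_tmul, hE, rowAction_apply]
      simp only [hE, Matrix.map_apply, unop_scalarHom_apply]
      simp only [smul_smul, ← Finset.sum_smul]
      congr 1
      simp [t, Matrix.vecMul, dotProduct, mul_comm]
  have hex : Function.Exact (t.lTensor V) (q.lTensor V) :=
    lTensor_exact V (by rw [LinearMap.exact_iff, ht, Submodule.ker_mkQ]) (rowSpan A).mkQ_surjective
  refine ⟨g, fun y => ?_, ?_⟩
  · obtain ⟨x, rfl⟩ := LinearMap.lTensor_surjective V (rowSpan A).mkQ_surjective y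
    exact ⟨E m x, hgE x⟩
  · ext w
    obtain ⟨x, rfl⟩ := (E m).surjective w
    rw [LinearMap.mem_ker, hgE]
    refine (hex x).trans ⟨?_, ?_⟩
    · rintro ⟨y, rfl⟩
      exact ⟨E n y, (htE y).symm⟩
    · rintro ⟨y, hy⟩
      obtain ⟨y, rfl⟩ := (E n).surjective y
      rw [← htE] at hy
      exact ⟨y, (E m).injective hy⟩

theorem matrixRankOf_eq_endRank [FiniteDimensional K V] [Nontrivial V] {d : FPModule O → ℝ}
    (hd : ∀ M : FPModule O, d M = (finrank K (V ⊗[O] M.carrier) : ℝ) / finrank K V)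
    (n m : ℕ) (A : Matrix (Fin n) (Fin m) O) :
    matrixRankOf d n m A = endRank K V n m (A.map (scalarHom O K V)) := by
  have hV : (0 : ℝ) < finrank K V := by exact_mod_cast finrank_pos
  obtain ⟨g, hg, hker⟩ := exists_exact_rowAction (K := K) (V := V) A
  have h := g.finrank_range_add_finrank_ker
  rw [hker, LinearMap.range_eq_top.mpr hg, finrank_top, finrank_pi_fintype, Finset.sum_const,
    Finset.card_univ, Fintype.card_fin, smul_eq_mul] at h
  have h' : (finrank K (V ⊗[O] ((Fin m → O) ⧸ rowSpan A)) : ℝ) +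
      finrank K (LinearMap.range (rowAction (A.map (scalarHom O K V)))) = m * finrank K V := by
    exact_mod_cast h
  unfold matrixRankOf endRank
  rw [hd]
  field_simp
  linarith

end Comparison

end

section

open Module MulOpposite

/-! ### Convex combinations over product rings -/

section Product

variable {ι : Type*} {U : ι → Type*} [∀ i, Ring (U i)]

theorem blockUpper_map {R S : Type*} [Ring R] [Ring S] (f : R →+* S) {n m k l : ℕ}
    (A : Matrix (Fin n) (Fin m) R) (C : Matrix (Fin n) (Fin l) R) (B : Matrix (Fin k) (Fin l) R) :
    (blockUpper A C B).map f = blockUpper (A.map f) (C.map f) (B.map f) := by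
  unfold blockUpper
  rw [Matrix.reindex_apply, Matrix.reindex_apply, ← Matrix.submatrix_map, Matrix.fromBlocks_map,
    Matrix.map_zero _ (map_zero f)]

theorem isVonNeumannRegular_pi (h : ∀ i, IsVonNeumannRegular (U i)) :
    IsVonNeumannRegular (∀ i, U i) := fun x => by
  choose y hy using fun i => h i (x i)
  exact ⟨y, funext hy⟩

/-- The convex combination of matrix rank functions on the factors of a product ring. -/
def piRank (c : ι → ℝ) (rk : ∀ i, ∀ n m : ℕ, Matrix (Fin n) (Fin m) (U i) → ℝ) (n m : ℕ)
    (A : Matrix (Fin n) (Fin m) (∀ i, U i)) : ℝ :=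
  ∑' i, c i * rk i n m (A.map (Pi.evalRingHom U i))

theorem isMatrixRank_piRank {ι : Type u} {U : ι → Type u} [∀ i, Ring (U i)] {c : ι → ℝ}
    (hc : ∀ i, 0 ≤ c i) (hs : HasSum c 1)
    {rk : ∀ i, ∀ n m : ℕ, Matrix (Fin n) (Fin m) (U i) → ℝ}
    (hrk : ∀ i, IsMatrixRank (U i) (rk i)) (hle : ∀ i n m A, rk i n m A ≤ m) :
    IsMatrixRank (∀ i, U i) (piRank c rk) := by
  have hsum : ∀ n m (A : Matrix (Fin n) (Fin m) (∀ i, U i)),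
      Summable fun i => c i * rk i n m (A.map (Pi.evalRingHom U i)) := fun n m A =>
    Summable.of_nonneg_of_le (fun i => mul_nonneg (hc i) ((hrk i).nonneg _ _ _))
      (fun i => mul_le_mul_of_nonneg_left (hle i _ _ _) (hc i)) (hs.summable.mul_right (m : ℝ))
  constructor
  · exact fun n m A => tsum_nonneg fun i => mul_nonneg (hc i) ((hrk i).nonneg _ _ _)
  · intro n m
    simp [piRank, Matrix.map_zero, (hrk _).zero]
  · simp [piRank, Matrix.map_one, (hrk _).one, hs.tsum_eq]
  · intro n m l A B
    refine le_min ((hsum _ _ _).tsum_le_tsum (fun i => ?_) (hsum _ _ _))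
      ((hsum _ _ _).tsum_le_tsum (fun i => ?_) (hsum _ _ _))
    all_goals
      refine mul_le_mul_of_nonneg_left ?_ (hc i)
      rw [Matrix.map_mul]
    · exact ((hrk i).mul_le _ _ _ _ _).trans (min_le_left _ _)
    · exact ((hrk i).mul_le _ _ _ _ _).trans (min_le_right _ _)
  · intro n m k l A B
    unfold piRank
    rw [← (hsum _ _ A).tsum_add (hsum _ _ B)]
    refine tsum_congr fun i => ?_
    rw [blockUpper_map, Matrix.map_zero _ (map_zero _), (hrk i).diag, mul_add]
  · intro n m k l A C B
    unfold piRank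
    rw [← (hsum _ _ A).tsum_add (hsum _ _ B)]
    refine ((hsum _ _ A).add (hsum _ _ B)).tsum_le_tsum (fun i => ?_) (hsum _ _ _)
    rw [blockUpper_map, ← mul_add]
    exact mul_le_mul_of_nonneg_left ((hrk i).upper _ _ _ _ _ _ _) (hc i)

end Product

/-! ### Regularity -/

section Regular

theorem exists_regular_of_finrank {O K V : Type u} [CommRing O] [Field K] [AddCommGroup V]
    [Module O V] [Module K V] [SMulCommClass O K V] [FiniteDimensional K V] [Nontrivial V]
    {d : FPModule O → ℝ}
    (hd : ∀ M : FPModule O, d M = (finrank K (V ⊗[O] M.carrier) : ℝ) / finrank K V) :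
    ∃ (U : Type u) (_ : Ring U) (φ : O →+* U) (rk : ∀ n m : ℕ, Matrix (Fin n) (Fin m) U → ℝ),
      IsVonNeumannRegular U ∧ IsMatrixRank U rk ∧ (∀ n m A, rk n m A ≤ m) ∧
      ∀ n m (A : Matrix (Fin n) (Fin m) O), matrixRankOf d n m A = rk n m (A.map φ) :=
  ⟨(End K V)ᵐᵒᵖ, inferInstance, scalarHom O K V, endRank K V, isVonNeumannRegular_end K V,
    isMatrixRank_endRank K V, endRank_le, matrixRankOf_eq_endRank hd⟩

/-- Over a local ring with nilpotent maximal ideal and a coefficient field, the length of a module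
is its dimension over the coefficient field. -/
theorem length_eq_of_section {A K : Type*} [CommRing A] [Field K] [Algebra K A]
    (π : A →+* K) (hker : IsNilpotent (RingHom.ker π)) (hπ : ∀ x, π (algebraMap K A x) = x)
    (N : Type*) [AddCommGroup N] [Module A N] [Module K N] [IsScalarTower K A N] :
    Module.length K N = Module.length A N := by
  -- An element `a` differs from the scalar `π a` by a nilpotent, so it is a unit once `π a` is.
  -- Hence `A` is local.
  have hloc : IsLocalHom π := by
    refine ⟨fun a ha => ?_⟩
    obtain ⟨n, hn⟩ := hker
    have h1 : algebraMap K A (π a) - a ∈ RingHom.ker π := by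
      rw [RingHom.mem_ker, map_sub, hπ, sub_self]
    have h2 : IsNilpotent (algebraMap K A (π a) - a) := by
      refine ⟨n, ?_⟩
      have := Ideal.pow_mem_pow h1 n
      rwa [hn] at this
    have h3 : IsUnit (algebraMap K A (π a)) := (ha.map (algebraMap K A))
    have h4 := IsNilpotent.isUnit_add_left_of_commute h2.neg h3 (Commute.all _ _)
    rwa [neg_sub, add_sub_cancel] at h4
  have : IsLocalRing A := RingHom.domain_isLocalRing π
  -- The residue fields of `K` and `A` agree, so restriction of scalars multiplies lengths by one.
  have hsurj : Function.Surjective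
      (algebraMap (IsLocalRing.ResidueField K) (IsLocalRing.ResidueField A)) := by
    intro a
    obtain ⟨a, rfl⟩ := IsLocalRing.residue_surjective a
    refine ⟨IsLocalRing.residue K (π a), ?_⟩
    change IsLocalRing.residue A (algebraMap K A (π a)) = _
    rw [← sub_eq_zero, ← map_sub, IsLocalRing.residue_eq_zero_iff, IsLocalRing.mem_maximalIdeal,
      mem_nonunits_iff]
    intro h
    have := h.map π
    rw [map_sub, hπ, sub_self] at this
    exact not_isUnit_zero this
  rw [IsLocalRing.length_restrictScalars K A N, Module.length_eq_of_surjective hsurj,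
    Module.length_eq_one (IsLocalRing.ResidueField A) (IsLocalRing.ResidueField A), mul_one]

variable {O : Type u} [CommRing O] [IsDedekindDomain O]

theorem exists_regular_dimZero :
    ∃ (U : Type u) (_ : Ring U) (φ : O →+* U) (rk : ∀ n m : ℕ, Matrix (Fin n) (Fin m) U → ℝ),
      IsVonNeumannRegular U ∧ IsMatrixRank U rk ∧ (∀ n m A, rk n m A ≤ m) ∧
      ∀ n m (A : Matrix (Fin n) (Fin m) O),
        matrixRankOf (dimZero O) n m A = rk n m (A.map φ) := by
  refine exists_regular_of_finrank (K := FractionRing O) (V := FractionRing O) fun M => ?_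
  rw [finrank_self, Nat.cast_one, div_one]
  rfl

/-- The coefficient field makes `V = O ⧸ m ^ k` a `k`-dimensional space over `O ⧸ m` on which `O`
acts linearly, and turns length into dimension. -/
theorem exists_regular_dimPow (hO : ¬ IsField O) (hF : ∃ F : Subring O, IsField F)
    (m : MaximalSpectrum O) (k : ℕ+) :
    ∃ (U : Type u) (_ : Ring U) (φ : O →+* U) (rk : ∀ n m : ℕ, Matrix (Fin n) (Fin m) U → ℝ),
      IsVonNeumannRegular U ∧ IsMatrixRank U rk ∧ (∀ n m A, rk n m A ≤ m) ∧
      ∀ n l (A : Matrix (Fin n) (Fin l) O),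
        matrixRankOf (dimPow m k) n l A = rk n l (A.map φ) := by
  have := m.isMaximal
  have hm := MaximalSpectrum.asIdeal_ne_bot hO m
  obtain ⟨s, hs⟩ := exists_section_quotient_pow hF m.asIdeal k k.ne_zero
  let _ : Field (O ⧸ m.asIdeal) := Ideal.Quotient.field m.asIdeal
  let _ : Algebra (O ⧸ m.asIdeal) (O ⧸ m.asIdeal ^ (k : ℕ)) := s.toAlgebra
  have : Nontrivial (O ⧸ m.asIdeal ^ (k : ℕ)) :=
    (Ideal.Quotient.factor (Ideal.pow_le_self k.ne_zero :
      m.asIdeal ^ (k : ℕ) ≤ m.asIdeal)).domain_nontrivial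
  have hlen := fun (N : Type u) [AddCommGroup N] [Module (O ⧸ m.asIdeal ^ (k : ℕ)) N]
      [Module (O ⧸ m.asIdeal) N] [IsScalarTower (O ⧸ m.asIdeal) (O ⧸ m.asIdeal ^ (k : ℕ)) N] =>
    length_eq_of_section (A := O ⧸ m.asIdeal ^ (k : ℕ)) (K := O ⧸ m.asIdeal)
      (Ideal.Quotient.factor (Ideal.pow_le_self k.ne_zero))
      (isNilpotent_ker_factor_pow _ _ k.ne_zero) hs N
  have hrank := fun (N : Type u) [AddCommGroup N] [Module (O ⧸ m.asIdeal) N] =>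
    show (Module.length (O ⧸ m.asIdeal) N).toNat = finrank (O ⧸ m.asIdeal) N by
      rw [Module.length_eq_rank]
      exact Cardinal.toNat_toENat _
  have hk : Module.length (O ⧸ m.asIdeal) (O ⧸ m.asIdeal ^ (k : ℕ)) = (k : ℕ) := by
    rw [hlen, length_quotient_pow_self hm]
  have hfin : FiniteDimensional (O ⧸ m.asIdeal) (O ⧸ m.asIdeal ^ (k : ℕ)) := by
    have h : Module.length (O ⧸ m.asIdeal) (O ⧸ m.asIdeal ^ (k : ℕ)) ≠ ⊤ := by
      rw [hk]
      exact ENat.natCast_ne_top _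
    rw [Module.length_ne_top_iff, isFiniteLength_iff_isNoetherian_isArtinian] at h
    have := h.1
    infer_instance
  refine exists_regular_of_finrank (K := O ⧸ m.asIdeal) (V := O ⧸ m.asIdeal ^ (k : ℕ)) fun M => ?_
  rw [← hrank, ← hrank, hk, hlen, ENat.toNat_natCast]
  rfl

theorem exists_regular_dimFamily (hO : ¬ IsField O) (hF : ∃ F : Subring O, IsField F)
    (i : Option (MaximalSpectrum O × ℕ+)) :
    ∃ (U : Type u) (_ : Ring U) (φ : O →+* U) (rk : ∀ n m : ℕ, Matrix (Fin n) (Fin m) U → ℝ),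
      IsVonNeumannRegular U ∧ IsMatrixRank U rk ∧ (∀ n m A, rk n m A ≤ m) ∧
      ∀ n m (A : Matrix (Fin n) (Fin m) O),
        matrixRankOf (dimFamily O i) n m A = rk n m (A.map φ) := by
  rcases i with _ | ⟨m, k⟩
  · exact exists_regular_dimZero
  · exact exists_regular_dimPow hO hF m k

theorem rankSpace_eq_regularRankSpace (hO : ¬ IsField O) (hF : ∃ F : Subring O, IsField F) :
    rankSpace O = regularRankSpace O := by
  refine Set.Subset.antisymm (fun d hd => ⟨hd, ?_⟩) fun d hd => hd.1
  obtain ⟨c, hc, hs, hM⟩ := IsModuleRank.exists_hasSum hO hd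
  choose U hU φ rk hreg hrk hle heq using exists_regular_dimFamily hO hF
  refine ⟨∀ i, U i, inferInstance, RingHom.pi φ, piRank c rk, isVonNeumannRegular_pi hreg,
    isMatrixRank_piRank hc hs hrk hle, fun n m A => ?_⟩
  -- Since the coefficients sum to one, the constant `m` in `m - d(M)` also distributes over the
  -- expansion.
  have h := (hs.mul_right (m : ℝ)).sub (hM (.of O ((Fin m → O) ⧸ rowSpan A)))
  rw [one_mul] at h
  refine (h.congr_fun fun i => ?_).tsum_eq.symm
  have hA : (A.map (RingHom.pi φ)).map (Pi.evalRingHom U i) = A.map (φ i) := rfl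
  rw [hA, ← heq]
  unfold matrixRankOf
  ring

end Regular

end

end Sylvester

end

theorem mainTheorem2 (O : Type u) [CommRing O] [IsDedekindDomain O] (hO : ¬ IsField O) :
    -- the extreme points
    (Sylvester.rankSpace O).extremePoints ℝ = Set.range (Sylvester.dimFamily O) ∧
    -- every rank function is a unique, possibly infinite, convex combination of them
    (∀ d ∈ Sylvester.rankSpace O,
      ∃! c : Option (MaximalSpectrum O × ℕ+) → ℝ,
        (∀ i, 0 ≤ c i) ∧ HasSum c 1 ∧
          ∀ M, HasSum (fun i => c i * Sylvester.dimFamily O i M) (d M)) ∧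
    -- regularity
    ((∃ F : Subring O, IsField F) →
      Sylvester.rankSpace O = Sylvester.regularRankSpace O) := by
  refine ⟨Sylvester.extremePoints_rankSpace hO, fun d hd => ?_,
    Sylvester.rankSpace_eq_regularRankSpace hO⟩
  obtain ⟨c, hc, hs, hM⟩ := Sylvester.IsModuleRank.exists_hasSum hO hd
  exact ⟨c, ⟨hc, hs, hM⟩, fun c' h' => Sylvester.eq_of_hasSum hO h'.2.1 hs h'.2.2 hM⟩
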